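/- A \emph{trinity} is a triangulation $\mathcal T$ of a closed connected oriented surface $\Sigma$ (several edges may have the same endpoints) whose vertices are colored red, green and blue so that the endpoints of every edge have different colors. Each edge is given the color that does not occur among its endpoints. The triangles are colored white or black according to the cyclic order of the three colors around them, so that every edge separates a white triangle from a black one. The trinity is \emph{toric} if $\Sigma$ is the torus. A \emph{Tutte matching} of a toric trinity is a perfect matching between the set of all white triangles and the set of all vertices in which each white triangle is matched to one of its own vertices. For a color $X$, let $G_X$ be the graph formed by the edges of color $X$ and the vertices of the other two colors, and let $G_X^*$ be its dual graph on $\Sigma$: its vertices are the vertices of color $X$, and for each edge $\varepsilon$ of color $X$ it has one directed edge crossing $\varepsilon$, which leads from the vertex of color $X$ of the black triangle at $\varepsilon$ to the vertex of color $X$ of the white triangle at $\varepsilon$. A \emph{wreath} in $G_X^*$ is a set $W$ of edges of $G_X^*$ such that every vertex of color $X$ has exactly one edge of $W$ pointing to it and no cycle formed by edges of $W$ separates $\Sigma$. (Loops and pairs of parallel edges count as cycles.) A Tutte matching \emph{extends} $W$ if for each edge of $W$ it matches the white triangle that the edge passes through to the vertex that the edge points to. \textbf{Theorem.} Let $\mathcal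 T$ be a toric trinity and let $X$ be any of the three colors (for instance red). \begin{enumerate} \item If $W$ is a wreath in $G_X^*$ that contains exactly $k$ cycles, then exactly $2^k$ Tutte matchings of $\mathcal T$ extend $W$. \item There exists a wreath in $G_X^*$. \item Consequently, $\mathcal T$ has a Tutte matching. \end{enumerate} -/

import Mathlib

/-- The three colours of the vertices of a trinity. An edge is coloured by the colour that does
not occur among its endpoints. -/
inductive TrinityColor : Type
  | red
  | green
  | blue
  deriving DecidableEq

instance : Fintype TrinityColor :=
  ⟨{TrinityColor.red, TrinityColor.green, TrinityColor.blue}, by rintro ⟨⟩ <;> simp⟩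

/-- A trinity (a triangulation of a closed oriented surface whose vertices are properly coloured
with three colours) with set of white triangles `W` and set of black triangles `B`.

Every triangle has one corner and one (opposite) edge of each colour. In a white triangle the
cyclic order of the colours, with respect to the orientation, is opposite to that in a black one,
so every edge lies on exactly one white and exactly one black triangle. The triangulation is thus
given by its gluing data: for every colour `c` and every white triangle `w`, the black triangle
`glue c w` on the other side of the edge of colour `c` of `w`; the edges are identified so that the
colours of their endpoints agree. As usual, several edges may have the same two endpoints. -/
structure Trinity (W B : Type*) where
  glue : TrinityColor → W ≃ B

namespace Trinity

variable {W B : Type*} (T : Trinity W B)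

/-- Two triangles, a white one and a black one, that are glued along an edge. -/
def GluedTriangles (s t : W ⊕ B) : Prop :=
  ∃ (w : W) (d : TrinityColor), s = Sum.inl w ∧ t = Sum.inr (T.glue d w)

/-- The identification of corners (pairs of a triangle and a colour) in the surface: if two
triangles are glued along an edge of colour `d`, then their corners of colour `c` are identified
for the two colours `c ≠ d`. -/
def GluedCorners (p q : (W ⊕ B) × TrinityColor) : Prop :=
  ∃ (w : W) (d c : TrinityColor),
    d ≠ c ∧ p = (Sum.inl w, c) ∧ q = (Sum.inr (T.glue d w), c)

/-- The vertices of the triangulation: the corners of the triangles up to the equivalence relation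
generated by the gluing. -/
def Vertex : Type _ := Quot T.GluedCorners

/-- The vertex of colour `c` of the triangle `t`. -/
def vertexOf (t : W ⊕ B) (c : TrinityColor) : T.Vertex := Quot.mk _ (t, c)

/-- The colour of a vertex. -/
def color : T.Vertex → TrinityColor :=
  Quot.lift Prod.snd (by rintro _ _ ⟨w, d, c, _, rfl, rfl⟩; rfl)

/-- The vertex of colour `c` of the white triangle `w`. -/
def whiteVertex (w : W) (c : TrinityColor) : T.Vertex := T.vertexOf (Sum.inl w) c

/-- The vertex of colour `c` of the black triangle `b`. -/
def blackVertex (b : B) (c : TrinityColor) : T.Vertex := T.vertexOf (Sum.inr b) c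

/-- The Euler characteristic (vertices minus edges plus triangles). An edge is given by the
unique white triangle on which it lies, together with its colour. -/
noncomputable def eulerChar : ℤ :=
  (Nat.card T.Vertex : ℤ) - (Nat.card (W × TrinityColor) : ℤ) + (Nat.card (W ⊕ B) : ℤ)

/-- The surface of the trinity is the torus: the connected closed orientable surface of Euler
characteristic `0`. -/
def IsToric : Prop :=
  (SimpleGraph.fromRel T.GluedTriangles).Connected ∧ T.eulerChar = 0

/-- A Tutte matching: a perfect matching between the white triangles and the vertices in which
every white triangle is matched to one of its own vertices. -/
def TutteMatching : Type _ :=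
  {m : W ≃ T.Vertex // ∀ w : W, ∃ c : TrinityColor, m w = T.whiteVertex w c}

/-! ### The directed graph dual to the graph of edges of colour `c`

The graph `G_c` has as vertices the vertices of the two colours other than `c`, and as edges the
edges of colour `c`. Its dual `G_c^*` is the directed graph whose vertices are the vertices of
colour `c` and which has one edge across each edge of colour `c`. The edges of both graphs are
indexed by the white triangles. -/

/-- The tail of the edge of `G_c^*` through the white triangle `w`: the edge starts at the vertex
of colour `c` of the black triangle on the other side of the edge of colour `c` of `w`. -/
def tail (c : TrinityColor) (w : W) : T.Vertex := T.blackVertex (T.glue c w) c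

/-- The head of the edge of `G_c^*` through the white triangle `w`. -/
def head (c : TrinityColor) (w : W) : T.Vertex := T.whiteVertex w c

/-- `C` is the edge set of a cycle of the multigraph underlying `G_c^*`: a closed walk of length
`m ≥ 1` without repeated vertices and edges. Loops are cycles of length `1`, and two different
edges with the same endpoints form a cycle of length `2`. -/
def IsCycle (c : TrinityColor) (C : Set W) : Prop :=
  ∃ (m : ℕ) (v : ZMod m → T.Vertex) (e : ZMod m → W),
    0 < m ∧ Function.Injective v ∧ Function.Injective e ∧ Set.range e = C ∧
      ∀ i : ZMod m, s(T.tail c (e i), T.head c (e i)) = s(v i, v (i + 1))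

/-- The (simple graph underlying the) graph `G_c` with the edges crossed by `C` removed. Its
vertices correspond to the regions into which `G_c^*` divides the surface, two regions being
adjacent if they lie on the two sides of an edge of `G_c^*` that does not belong to `C`. Hence its
connected components correspond to those of the complement of `C` in the surface. -/
def complementGraph (c : TrinityColor) (C : Set W) :
    SimpleGraph {x : T.Vertex // T.color x ≠ c} where
  Adj x y := x ≠ y ∧ ∃ w : W, w ∉ C ∧
    (∃ d, x.1 = T.whiteVertex w d) ∧ (∃ d, y.1 = T.whiteVertex w d)
  symm := ⟨fun _ _ ⟨hne, w, hw, hx, hy⟩ => ⟨hne.symm, w, hw, hy, hx⟩⟩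
  loopless := ⟨fun _ h => h.1 rfl⟩

/-- A set of edges of `G_c^*` separates the surface if its complement in the surface is
disconnected. -/
def IsSeparating (c : TrinityColor) (C : Set W) : Prop :=
  ¬ (T.complementGraph c C).Connected

/-- A wreath in `G_c^*`: a set of edges such that exactly one of them points to each vertex of
colour `c`, and which contains no separating cycle. -/
def IsWreath (c : TrinityColor) (S : Set W) : Prop :=
  (∀ x : T.Vertex, T.color x = c → ∃! w : W, w ∈ S ∧ T.head c w = x) ∧
    ∀ C : Set W, C ⊆ S → T.IsCycle c C → ¬ T.IsSeparating c C

/-- The number of cycles contained in a set of edges of `G_c^*`. -/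
noncomputable def numCycles (c : TrinityColor) (S : Set W) : ℕ :=
  {C : Set W | C ⊆ S ∧ T.IsCycle c C}.ncard

/-- The Tutte matching `m` extends the set `S` of edges of `G_c^*`: the edge through the white
triangle `w`, read as an arrow, stands for matching `w` to the vertex at its head. -/
def Extends (c : TrinityColor) (m : T.TutteMatching) (S : Set W) : Prop :=
  ∀ w ∈ S, m.1 w = T.head c w

end Trinity

/-!
A set of edges of `G_c^*` with one edge into every vertex is a section `s` of the head map, and it
gives the self-map `pred` of the set of vertices that sends the head of a chosen edge to its tail.
The cycles formed by the chosen edges are the periodic orbits of `pred`.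

*Existence.* As the Euler characteristic is zero, there is a cocycle `φ` modulo 2 on `G_c^*` that
vanishes on boundaries but is not a coboundary. For this reason the Laplacian of the directed graph
`G_c^*`, twisted by the signs `(-1) ^ φ`, is nonsingular. Its determinant is a sum over the
sections, and a section contributes zero as soon as the sum of `φ` along one of its cycles
vanishes. In a section with a nonzero contribution no cycle is a boundary, that is, no cycle
separates.

*Counting.* Let `k` be the number of cycles of a wreath, and remove its edges from `G_c`. The graph
that remains has equal Betti numbers `b₀ = b₁` by the Euler formula. Each cycle has two sides, which
gives `2 * k ≤ b₀ + b₁`, while `b₀ ≤ k` since the cycles do not separate. So `b₀ = k`, and a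
component without a cycle would contradict nonseparation again. Hence each of the `k` components
is unicyclic, and a Tutte matching extending the wreath is a choice of one of the two orientations
of the cycle in each component.
-/

open Function

/-! ### Self-maps -/

section SelfMap

variable {X : Type*} {f : X → X} {u v : X}

theorem exists_iterate_mem_periodicPts [Finite X] (f : X → X) :
    ∃ n, ∀ v, f^[n] v ∈ periodicPts f := by
  obtain ⟨i, j, hij, h⟩ := Finite.exists_ne_map_eq_of_infinite (fun n : ℕ => f^[n])
  wlog hlt : i < j generalizing i j
  · exact this j i hij.symm h.symm (lt_of_le_of_ne (not_lt.1 hlt) hij.symm)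
  refine ⟨i, fun v => mk_mem_periodicPts (Nat.sub_pos_of_lt hlt) ?_⟩
  change f^[j - i] (f^[i] v) = f^[i] v
  rw [← iterate_add_apply, Nat.sub_add_cancel hlt.le]
  exact (congrFun h v).symm

theorem iterate_mem_periodicPts (hv : v ∈ periodicPts f) (n : ℕ) : f^[n] v ∈ periodicPts f :=
  (bijOn_periodicPts f).mapsTo.iterate n hv

/-- The set of all iterates of a point under a self-map, the point itself included. -/
def forwardOrbit (f : X → X) (v : X) : Set X := Set.range fun n => f^[n] v

theorem self_mem_forwardOrbit (f : X → X) (v : X) : v ∈ forwardOrbit f v := ⟨0, rfl⟩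

theorem mem_forwardOrbit_iterate (hv : v ∈ periodicPts f) (n : ℕ) :
    v ∈ forwardOrbit f (f^[n] v) := by
  obtain ⟨k, hk, hper⟩ := hv
  refine ⟨n * k - n, ?_⟩
  change f^[n * k - n] (f^[n] v) = v
  rw [← iterate_add_apply, Nat.sub_add_cancel (Nat.le_mul_of_pos_right n hk)]
  exact hper.const_mul n

theorem forwardOrbit_subset_of_mem (h : u ∈ forwardOrbit f v) :
    forwardOrbit f u ⊆ forwardOrbit f v := by
  obtain ⟨n, rfl⟩ := h
  rintro _ ⟨m, rfl⟩
  exact ⟨m + n, iterate_add_apply f m n v⟩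

theorem forwardOrbit_eq_of_mem (hv : v ∈ periodicPts f) (h : u ∈ forwardOrbit f v) :
    forwardOrbit f u = forwardOrbit f v := by
  refine (forwardOrbit_subset_of_mem h).antisymm ?_
  obtain ⟨n, rfl⟩ := h
  exact forwardOrbit_subset_of_mem (mem_forwardOrbit_iterate hv n)

theorem forwardOrbit_eq_image_range (hv : v ∈ periodicPts f) [DecidableEq X] :
    forwardOrbit f v = (Finset.range (minimalPeriod f v)).image fun n => f^[n] v := by
  ext u
  simp only [forwardOrbit, Set.mem_range, Finset.coe_image, Finset.coe_range, Set.mem_image,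
    Set.mem_Iio]
  constructor
  · rintro ⟨n, rfl⟩
    exact ⟨n % minimalPeriod f v, Nat.mod_lt _ (minimalPeriod_pos_of_mem_periodicPts hv),
      iterate_mod_minimalPeriod_eq⟩
  · rintro ⟨n, -, rfl⟩
    exact ⟨n, rfl⟩

/-- The functions that are constant along the orbits of a self-map. -/
def invariantFun (K : Type*) [Semiring K] (f : X → X) : Submodule K (X → K) where
  carrier := {p | ∀ v, p (f v) = p v}
  add_mem' hp hq v := by simp only [Pi.add_apply, hp v, hq v]
  zero_mem' _ := rfl
  smul_mem' r p hp v := by simp only [Pi.smul_apply, hp v]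

theorem invariantFun_apply_iterate {K : Type*} [Semiring K] {p : X → K}
    (hp : p ∈ invariantFun K f) (n : ℕ) (v : X) : p (f^[n] v) = p v := by
  induction n with
  | zero => rfl
  | succ n ih => rw [iterate_succ_apply', hp, ih]

/-- The points from which the forward orbit of `v` is reached. -/
def basin (f : X → X) (v : X) : Set X := {u | ∃ n, f^[n] u ∈ forwardOrbit f v}

theorem self_mem_basin (f : X → X) (v : X) : v ∈ basin f v := ⟨0, self_mem_forwardOrbit f v⟩

theorem mem_forwardOrbit_of_mem_basin (hu : u ∈ periodicPts f) (h : u ∈ basin f v) :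
    u ∈ forwardOrbit f v := by
  obtain ⟨n, hn⟩ := h
  exact forwardOrbit_subset_of_mem hn (mem_forwardOrbit_iterate hu n)

theorem apply_mem_basin_iff : f u ∈ basin f v ↔ u ∈ basin f v := by
  constructor
  · rintro ⟨n, hn⟩
    exact ⟨n + 1, hn⟩
  · rintro ⟨n, hn⟩
    refine ⟨n, forwardOrbit_subset_of_mem hn ?_⟩
    rw [← iterate_succ_apply, iterate_succ_apply']
    exact ⟨1, rfl⟩

theorem indicator_basin_mem_invariantFun (K : Type*) [Semiring K] (f : X → X) (v : X) :
    (basin f v).indicator 1 ∈ invariantFun K f := by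
  classical
  intro u
  simp only [Set.indicator_apply, apply_mem_basin_iff, Pi.one_apply]

theorem finrank_invariantFun (K : Type*) [Field K] [Finite X] (f : X → X) :
    Module.finrank K (invariantFun K f) = (forwardOrbit f '' periodicPts f).ncard := by
  obtain ⟨n, hn⟩ := exists_iterate_mem_periodicPts f
  let orb (v : X) : forwardOrbit f '' periodicPts f :=
    ⟨forwardOrbit f (f^[n] v), Set.mem_image_of_mem _ (hn v)⟩
  have orb_surjective : Surjective orb := by
    rintro ⟨_, v, hv, rfl⟩
    obtain ⟨u, -, rfl⟩ := ((bijOn_periodicPts f).iterate n).surjOn hv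
    exact ⟨u, rfl⟩
  have orb_comp (v : X) : orb (f v) = orb v := Subtype.ext <|
    forwardOrbit_eq_of_mem (hn v) ⟨1, (iterate_succ_apply' f n v).symm.trans
      (iterate_succ_apply f n v)⟩
  have range_eq : LinearMap.range (LinearMap.funLeft K K orb) = invariantFun K f := by
    refine le_antisymm ?_ fun p hp => ?_
    · rintro _ ⟨q, rfl⟩ v
      exact congrArg q (orb_comp v)
    · refine ⟨fun C => p (surjInv orb_surjective C), funext fun v => ?_⟩
      have h := congrArg Subtype.val (surjInv_eq orb_surjective (orb v))
      obtain ⟨m, hm⟩ := h.subset (self_mem_forwardOrbit f _)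
      rw [LinearMap.funLeft_apply, ← invariantFun_apply_iterate hp n, ← hm,
        invariantFun_apply_iterate hp, invariantFun_apply_iterate hp]
  have := Fintype.ofFinite (forwardOrbit f '' periodicPts f)
  rw [← range_eq, LinearMap.finrank_range_of_inj
    (LinearMap.funLeft_injective_of_surjective K K orb orb_surjective),
    Module.finrank_fintype_fun_eq_card, ← Nat.card_eq_fintype_card, Nat.card_coe_set_eq]

section FibreSum

variable [Fintype X] [DecidableEq X] {M : Type*} [AddCommMonoid M] {g : X → M}

theorem eq_zero_of_fibre_sum_eq (hg : ∀ v, ∑ u with f u = v, g u = g v) (hv : v ∉ periodicPts f) :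
    g v = 0 := by
  have vanish (n : ℕ) : ∀ v ∉ Set.range f^[n], g v = 0 := by
    induction n with
    | zero => exact fun v hv => absurd ⟨v, rfl⟩ hv
    | succ n ih =>
      intro v hv
      rw [← hg v]
      refine Finset.sum_eq_zero fun u hu => ih u ?_
      rintro ⟨t, rfl⟩
      exact hv ⟨t, by rw [iterate_succ_apply', (Finset.mem_filter.1 hu).2]⟩
  obtain ⟨n, hn⟩ := exists_iterate_mem_periodicPts f
  refine vanish n v ?_
  rintro ⟨u, rfl⟩
  exact hv (hn u)

theorem apply_eq_of_fibre_sum_eq (hg : ∀ v, ∑ u with f u = v, g u = g v)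
    (hv : v ∈ periodicPts f) : g (f v) = g v := by
  rw [← hg (f v)]
  refine Finset.sum_eq_single_of_mem v (by simp) fun u hu huv => eq_zero_of_fibre_sum_eq hg ?_
  exact fun hu' => huv ((bijOn_periodicPts f).injOn hu' hv (Finset.mem_filter.1 hu).2)

theorem apply_eq_of_fibre_sum_eq_of_mem_forwardOrbit (hg : ∀ v, ∑ u with f u = v, g u = g v)
    (hv : v ∈ periodicPts f) (hu : u ∈ forwardOrbit f v) : g u = g v := by
  obtain ⟨n, rfl⟩ := hu
  induction n with
  | zero => rfl
  | succ n ih =>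
    exact (congrArg g (iterate_succ_apply' f n v)).trans
      ((apply_eq_of_fibre_sum_eq hg (iterate_mem_periodicPts hv n)).trans ih)

end FibreSum

theorem exists_sub_comp_eq [Finite X] {M : Type*} [AddCommGroup M] {h : X → M}
    (hh : ∀ v ∈ periodicPts f, h v = 0) :
    ∃ p : X → M, (∀ v, p v - p (f v) = h v) ∧ ∀ v ∈ periodicPts f, p v = 0 := by
  obtain ⟨n, hn⟩ := exists_iterate_mem_periodicPts f
  refine ⟨fun v => ∑ j ∈ Finset.range n, h (f^[j] v), fun v => ?_, fun v hv =>
    Finset.sum_eq_zero fun j _ => hh _ (iterate_mem_periodicPts hv j)⟩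
  simp only [← iterate_succ_apply]
  rw [← Finset.sum_sub_distrib, Finset.sum_range_sub' (fun j => h (f^[j] v)), hh _ (hn v), sub_zero,
    iterate_zero_apply]

/-- A cycle with product of weights `1` gives a linear relation between its rows. -/
theorem det_single_sub_single_eq_zero [Fintype X] [DecidableEq X] {R : Type*} [CommRing R]
    [IsDomain R] (f : X → X) (c : X → R) (hv : v ∈ periodicPts f)
    (hc : ∏ j ∈ Finset.range (minimalPeriod f v), c (f^[j] v) = 1) :
    (Matrix.of fun u => (Pi.single u 1 - Pi.single (f u) (c u) : X → R)).det = 0 := by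
  set n := minimalPeriod f v with hn
  let g (j : ℕ) : R := ∏ i ∈ Finset.range j, c (f^[i] v)
  rw [← Matrix.exists_vecMul_eq_zero_iff]
  refine ⟨∑ j ∈ Finset.range n, Pi.single (f^[j] v) (g j), fun h => ?_, ?_⟩
  · have hval := congrFun h v
    rw [Finset.sum_apply, Finset.sum_eq_single_of_mem 0
      (Finset.mem_range.2 (minimalPeriod_pos_of_mem_periodicPts hv))] at hval
    · simp [g] at hval
    · intro j hj hj0
      refine Pi.single_eq_of_ne (fun hjv => hj0 ?_) _
      exact iterate_injOn_Iio_minimalPeriod (Finset.mem_range.1 hj)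
        (minimalPeriod_pos_of_mem_periodicPts hv) hjv.symm
  · have telescope (j : ℕ) : Matrix.vecMul (Pi.single (f^[j] v) (g j))
        (Matrix.of fun u => (Pi.single u 1 - Pi.single (f u) (c u) : X → R)) =
        Pi.single (f^[j] v) (g j) - Pi.single (f^[j + 1] v) (g (j + 1)) := by
      rw [Matrix.single_vecMul, iterate_succ_apply']
      ext u
      simp [g, Finset.prod_range_succ, Pi.single_apply, mul_sub]
    rw [Matrix.sum_vecMul, Finset.sum_congr rfl fun j _ => telescope j,
      Finset.sum_range_sub' (fun j => (Pi.single (f^[j] v) (g j) : X → R)), show g n = 1 from hc,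
      hn, iterate_minimalPeriod, iterate_zero_apply, show g 0 = 1 from Finset.prod_range_zero _,
      sub_self]

end SelfMap

theorem mem_periodicPts_and_range_eq_forwardOrbit {X : Type*} {f : X → X} {m : ℕ} (hm : 0 < m)
    {x : ZMod m → X} (hx : ∀ i, f (x i) = x (i + 1)) :
    x 0 ∈ periodicPts f ∧ Set.range x = forwardOrbit f (x 0) := by
  have iterate_eq (n : ℕ) : f^[n] (x 0) = x n := by
    induction n with
    | zero => simp
    | succ n ih => rw [iterate_succ_apply', ih, hx, Nat.cast_succ]
  have : NeZero m := ⟨hm.ne'⟩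
  refine ⟨mk_mem_periodicPts hm ((iterate_eq m).trans (by rw [ZMod.natCast_self])), ?_⟩
  rw [forwardOrbit, funext iterate_eq]
  exact (Surjective.range_comp (ZMod.natCast_zmod_surjective) x).symm

theorem eq_id_or_eq_add_one_of_injective {m : ℕ} [NeZero m] {σ : ZMod m → ZMod m}
    (hσ : Injective σ) (h : ∀ i, σ i = i ∨ σ i = i + 1) :
    (∀ i, σ i = i) ∨ ∀ i, σ i = i + 1 := by
  by_contra! hcon
  obtain ⟨⟨i, hi⟩, j, hj⟩ := hcon
  have eq_add_one (n : ℕ) : σ (i + n) = i + n + 1 := by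
    induction n with
    | zero => simpa using (h i).resolve_left hi
    | succ n ih =>
      rw [Nat.cast_succ, ← add_assoc]
      refine (h _).resolve_left fun heq => ?_
      have : i + n + 1 = i + n := hσ (heq.trans ih.symm)
      exact hi (by simp_all)
  obtain ⟨n, hn⟩ := ZMod.natCast_zmod_surjective (j - i)
  exact hj (by simpa [hn] using eq_add_one n)

/-- The frequencies with which the arc of the cycle from `p` to `q` passes through a point. -/
theorem exists_sub_eq_single_sub_single {W : Type*} {R : Type*} [Ring R] [DecidableEq W] [Finite W]
    {ρ : Equiv.Perm W} {p q : W} (h : ρ.SameCycle p q) :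
    ∃ u : W → R, (∀ w, u (ρ w) - u w = (if ρ w = p then 1 else 0) - (if w = q then 1 else 0)) ∧
      u p = 1 ∧ u q = 1 := by
  have hex := h.exists_nat_pow_eq
  set n := Nat.find hex
  have hn : (ρ ^ n) p = q := Nat.find_spec hex
  have ne_q {j : ℕ} (hj : j < n) : (ρ ^ j) p ≠ q := Nat.find_min hex hj
  have ne_p {j : ℕ} (hj0 : 0 < j) (hj : j ≤ n) : (ρ ^ j) p ≠ p := fun hp => by
    refine ne_q (j := n - j) (by omega) ?_
    rw [← hn, ← Nat.sub_add_cancel hj, pow_add, Equiv.Perm.mul_apply, hp, Nat.add_sub_cancel]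
  let u (w : W) : R := ∑ j ∈ Finset.range (n + 1), if (ρ ^ j) p = w then 1 else 0
  refine ⟨u, fun w => ?_, ?_, ?_⟩
  · have shift (j : ℕ) : (ρ ^ j) p = w ↔ (ρ ^ (j + 1)) p = ρ w := by
      rw [pow_succ', Equiv.Perm.mul_apply, ρ.apply_eq_iff_eq]
    have hw : u w = ∑ j ∈ Finset.range (n + 1), if (ρ ^ (j + 1)) p = ρ w then (1 : R) else 0 := by
      simp only [u, shift]
    rw [hw, ← Finset.sum_sub_distrib,
      Finset.sum_range_sub' fun j => if (ρ ^ j) p = ρ w then (1 : R) else 0,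
      ← if_congr (shift n) rfl rfl, hn, pow_zero, Equiv.Perm.one_apply]
    simp only [eq_comm]
  · refine (Finset.sum_eq_single_of_mem 0 (by simp) fun j hj hj0 => if_neg ?_).trans (by simp)
    exact ne_p (Nat.pos_of_ne_zero hj0) (Finset.mem_range_succ_iff.1 hj)
  · refine (Finset.sum_eq_single_of_mem n (by simp) fun j hj hjn => if_neg ?_).trans (by simp [hn])
    exact ne_q (lt_of_le_of_ne (Finset.mem_range_succ_iff.1 hj) hjn)

theorem exists_equiv_forall_ne_zero {W ι K : Type*} [Field K] [Fintype W] [Fintype ι]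
    (hcard : Fintype.card W = Fintype.card ι) {row : W → ι → K}
    (hrow : ∀ y, (∀ w, row w ⬝ᵥ y = 0) → y = 0) : ∃ m : W ≃ ι, ∀ w, row w (m w) ≠ 0 := by
  classical
  let e := Fintype.equivOfCardEq hcard
  have hdet : (Matrix.of fun i => row (e.symm i)).det ≠ 0 := by
    intro h
    obtain ⟨y, hy, hMy⟩ := Matrix.exists_mulVec_eq_zero_iff.2 h
    exact hy (hrow y fun w => by simpa [Matrix.mulVec] using congrFun hMy (e w))
  rw [Matrix.det_apply'] at hdet
  obtain ⟨σ, -, hσ⟩ := Finset.exists_ne_zero_of_sum_ne_zero hdet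
  refine ⟨e.trans σ⁻¹, fun w => ?_⟩
  simpa using Finset.prod_ne_zero_iff.1 (right_ne_zero_of_mul hσ) (σ⁻¹ (e w)) (Finset.mem_univ _)

/-! ### Bipartite maps -/

theorem apply_eq_of_mem_closure {W α : Type*} {F : W → α} {P : Set (Equiv.Perm W)}
    (hF : ∀ g ∈ P, ∀ w, F (g w) = F w) {g : Equiv.Perm W} (hg : g ∈ Subgroup.closure P) (w : W) :
    F (g w) = F w := by
  induction hg using Subgroup.closure_induction generalizing w with
  | mem g hg => exact hF g hg w
  | one => rfl
  | mul g h _ _ ihg ihh => exact (ihg (h w)).trans (ihh w)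
  | inv g _ ih => exact (ih (g⁻¹ w)).symm.trans (by simp)

theorem apply_eq_of_sameCycle {W α : Type*} {F : W → α} {ρ : Equiv.Perm W}
    (hF : ∀ w, F (ρ w) = F w) {w w' : W} (h : ρ.SameCycle w w') : F w = F w' := by
  obtain ⟨n, rfl⟩ := h
  exact (apply_eq_of_mem_closure (P := {ρ}) (by simpa using hF)
    (Subgroup.zpow_mem _ (Subgroup.mem_closure_singleton_self ρ) n) w).symm

theorem finrank_orthogonal_range_add {K V ι : Type*} [Field K] [AddCommGroup V] [Module K V]
    [FiniteDimensional K V] [Fintype ι] (D : V →ₗ[K] (ι → K)) :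
    Module.finrank K (LinearMap.BilinForm.orthogonal (dotProductBilin K K) (LinearMap.range D)) +
        Module.finrank K V =
      Module.finrank K (LinearMap.ker D) + Nat.card ι := by
  let B : LinearMap.BilinForm K (ι → K) := dotProductBilin K K
  have ker_eq_bot : B.ker = ⊥ := LinearMap.ker_eq_bot'.2 fun φ hφ =>
    dotProduct_eq_zero φ fun ψ => LinearMap.congr_fun hφ ψ
  have h1 := LinearMap.BilinForm.finrank_add_finrank_orthogonal' (B := B) (LinearMap.range D)
  have h2 := LinearMap.finrank_range_add_finrank_ker D
  rw [ker_eq_bot, inf_bot_eq, finrank_bot, Module.finrank_fintype_fun_eq_card,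
    ← Nat.card_eq_fintype_card] at h1
  change Module.finrank K (B.orthogonal (LinearMap.range D)) + _ = _
  omega

/-- A connected bipartite graph with edges `W` and vertices `U`, embedded in a closed oriented
surface with faces `X`. The two ends of an edge `w` are the vertices `a w` and `b w` of the two
parts of the graph, and `ε` and `δ` rotate the edges about these ends. One of the two faces at `w`
is `hd w`; the other one is `hd (ε w) = hd (δ w)`, so the dual edge across `w` leads from it to
`hd w`. -/
structure BipartiteMap (W X U : Type*) where
  δ : Equiv.Perm W
  ε : Equiv.Perm W
  hd : W → X
  a : W → U
  b : W → U
  hd_surjective : Surjective hd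
  hd_eq_iff : ∀ w w', hd w = hd w' ↔ (δ * ε⁻¹).SameCycle w w'
  a_eq_iff : ∀ w w', a w = a w' ↔ ε.SameCycle w w'
  b_eq_iff : ∀ w w', b w = b w' ↔ δ.SameCycle w w'
  a_ne_b : ∀ w w', a w ≠ b w'
  exists_end : ∀ x, ∃ w, a w = x ∨ b w = x
  isPretransitive : MulAction.IsPretransitive (Subgroup.closure {δ, ε}) W
  nonempty : Nonempty W

namespace BipartiteMap

variable {W X U : Type*}

theorem nonempty_vertices (H : BipartiteMap W X U) : Nonempty U := H.nonempty.map H.a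

variable (H : BipartiteMap W X U)

theorem a_ε (w : W) : H.a (H.ε w) = H.a w :=
  (H.a_eq_iff _ _).2 (Equiv.Perm.sameCycle_apply_left.2 (Equiv.Perm.SameCycle.refl _ _))

theorem b_δ (w : W) : H.b (H.δ w) = H.b w :=
  (H.b_eq_iff _ _).2 (Equiv.Perm.sameCycle_apply_left.2 (Equiv.Perm.SameCycle.refl _ _))

theorem hd_δ (w : W) : H.hd (H.δ w) = H.hd (H.ε w) :=
  (H.hd_eq_iff _ _).2 ⟨-1, by simp⟩

theorem apply_eq_of_invariant {α : Type*} {F : W → α} (hδ : ∀ w, F (H.δ w) = F w)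
    (hε : ∀ w, F (H.ε w) = F w) (w w' : W) : F w = F w' := by
  obtain ⟨g, rfl⟩ := H.isPretransitive.exists_smul_eq w w'
  refine (apply_eq_of_mem_closure ?_ g.2 w).symm
  rintro _ (rfl | rfl)
  exacts [hδ, hε]

theorem exists_apply_a_eq_apply_b_eq {α : Type*} {F G : W → α} (hF : ∀ w, F (H.ε w) = F w)
    (hG : ∀ w, G (H.δ w) = G w) :
    ∃ f : U → α, (∀ w, f (H.a w) = F w) ∧ ∀ w, f (H.b w) = G w := by
  have hval (x : U) : ∃ r, (∀ w, H.a w = x → F w = r) ∧ ∀ w, H.b w = x → G w = r := by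
    obtain ⟨w, rfl | rfl⟩ := H.exists_end x
    · exact ⟨F w, fun w' h => apply_eq_of_sameCycle hF ((H.a_eq_iff _ _).1 h),
        fun w' h => absurd h.symm (H.a_ne_b _ _)⟩
    · exact ⟨G w, fun w' h => absurd h (H.a_ne_b _ _),
        fun w' h => apply_eq_of_sameCycle hG ((H.b_eq_iff _ _).1 h)⟩
  choose f hfa hfb using hval
  exact ⟨f, fun w => (hfa _ w rfl).symm, fun w => (hfb _ w rfl).symm⟩

/-- The tail of the dual edge across `w`. -/
def tl (w : W) : X := H.hd (H.ε w)

/-- The face at the tail of the dual edge chosen for a given face, where a choice `s` of dual edges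
into all faces is understood. -/
def pred (s : X → W) (v : X) : X := H.tl (s v)

/-- The dual edges that a choice `s` of dual edges into all faces assigns to the iterated
predecessors of `v`. They form a cycle of the dual graph if `v` is periodic. -/
def orbitEdges (s : X → W) (v : X) : Set W := s '' forwardOrbit (H.pred s) v

/-- The graph without the edges in `C`. -/
def cut (C : Set W) : SimpleGraph U where
  Adj x y := x ≠ y ∧ ∃ w, w ∉ C ∧ (x = H.a w ∨ x = H.b w) ∧ (y = H.a w ∨ y = H.b w)
  symm := ⟨fun _ _ ⟨h, w, hw, hx, hy⟩ => ⟨h.symm, w, hw, hy, hx⟩⟩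
  loopless := ⟨fun _ h => h.1 rfl⟩

/-- No cycle of the dual graph formed by the chosen dual edges separates the surface. -/
def IsNonseparating (s : X → W) : Prop :=
  ∀ v ∈ periodicPts (H.pred s), (H.cut (H.orbitEdges s v)).Connected

/-- The Euler characteristic of the surface is zero. -/
def IsToric (_ : BipartiteMap W X U) : Prop := Nat.card W = Nat.card X + Nat.card U

section Gradient

variable (K : Type*) [Field K]

/-- The differences of a function on the vertices along the edges. -/
def grad : (U → K) →ₗ[K] (W → K) := LinearMap.funLeft K K H.a - LinearMap.funLeft K K H.b

/-- The differences of a function on the faces along the dual edges. -/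
def cograd : (X → K) →ₗ[K] (W → K) := LinearMap.funLeft K K H.hd - LinearMap.funLeft K K H.tl

/-- The functions on the vertices that are constant along the edges outside `S`. -/
def cutFun (S : Set W) : Submodule K (U → K) where
  carrier := {f | ∀ w ∉ S, H.grad K f w = 0}
  add_mem' hf hg w hw := by rw [map_add, Pi.add_apply, hf w hw, hg w hw, add_zero]
  zero_mem' w _ := by rw [map_zero, Pi.zero_apply]
  smul_mem' r f hf w hw := by rw [map_smul, Pi.smul_apply, hf w hw, smul_zero]

/-- The circulations of the graph, with respect to the orientation of the edges from one part to
the other, that avoid the edges in `S`. -/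
def flows [Fintype W] (S : Set W) : Submodule K (W → K) where
  carrier := {φ | (∀ w ∈ S, φ w = 0) ∧ ∀ f, φ ⬝ᵥ H.grad K f = 0}
  add_mem' hφ hψ := ⟨fun w hw => by rw [Pi.add_apply, hφ.1 w hw, hψ.1 w hw, add_zero],
    fun f => by rw [add_dotProduct, hφ.2 f, hψ.2 f, add_zero]⟩
  zero_mem' := ⟨fun _ _ => rfl, fun _ => zero_dotProduct _⟩
  smul_mem' r φ hφ := ⟨fun w hw => by rw [Pi.smul_apply, hφ.1 w hw, smul_zero],
    fun f => by rw [smul_dotProduct, hφ.2 f, smul_zero]⟩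

/-- The set `C` of dual edges is the boundary of a `K`-valued 2-chain. -/
def IsBoundary (C : Set W) : Prop := C.indicator 1 ∈ LinearMap.range (H.grad K)

variable {K} {S : Set W} {f : U → K}

theorem grad_apply (f : U → K) (w : W) : H.grad K f w = f (H.a w) - f (H.b w) := rfl

theorem cograd_apply (p : X → K) (w : W) : H.cograd K p w = p (H.hd w) - p (H.tl w) := rfl

theorem apply_a_eq_apply_b (hf : f ∈ H.cutFun K S) {w : W} (hw : w ∉ S) :
    f (H.a w) = f (H.b w) := sub_eq_zero.1 (hf w hw)

theorem cutFun_mono {S S' : Set W} (h : S ⊆ S') : H.cutFun K S ≤ H.cutFun K S' :=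
  fun _ hf w hw => hf w fun hwS => hw (h hwS)

theorem grad_indicator_one_eq_zero_iff {C : Set U} {w : W} :
    H.grad K (C.indicator 1) w = 0 ↔ (H.a w ∈ C ↔ H.b w ∈ C) := by
  classical
  rw [grad_apply, Set.indicator_apply, Set.indicator_apply]
  by_cases ha : H.a w ∈ C <;> by_cases hb : H.b w ∈ C <;> simp [ha, hb]

theorem apply_eq_of_grad_eq_zero (hf : H.grad K f = 0) (x y : U) : f x = f y := by
  have hab (w : W) : f (H.a w) = f (H.b w) := sub_eq_zero.1 (congrFun hf w)
  have const (w w' : W) : f (H.a w) = f (H.a w') :=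
    H.apply_eq_of_invariant (F := fun w => f (H.a w)) (fun w => by rw [hab, b_δ, hab])
      (fun w => by rw [a_ε]) w w'
  have hsurj (x : U) : ∃ w, f x = f (H.a w) := by
    obtain ⟨w, rfl | rfl⟩ := H.exists_end x
    exacts [⟨w, rfl⟩, ⟨w, (hab w).symm⟩]
  obtain ⟨w, hw⟩ := hsurj x
  obtain ⟨w', hw'⟩ := hsurj y
  rw [hw, hw', const]

theorem reachable_a_b {w : W} (hw : w ∉ S) : (H.cut S).Reachable (H.a w) (H.b w) :=
  SimpleGraph.Adj.reachable ⟨H.a_ne_b w w, w, hw, Or.inl rfl, Or.inr rfl⟩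

theorem apply_eq_of_reachable (hf : f ∈ H.cutFun K S) {x y : U} (h : (H.cut S).Reachable x y) :
    f x = f y := by
  obtain ⟨p⟩ := h
  induction p with
  | nil => rfl
  | cons hadj _ ih =>
    rw [← ih]
    obtain ⟨-, w, hw, rfl | rfl, rfl | rfl⟩ := hadj
    exacts [rfl, H.apply_a_eq_apply_b hf hw, (H.apply_a_eq_apply_b hf hw).symm, rfl]

theorem indicator_supp_mem_cutFun (C : (H.cut S).ConnectedComponent) :
    C.supp.indicator 1 ∈ H.cutFun K S := fun w hw => by
  rw [grad_indicator_one_eq_zero_iff, SimpleGraph.ConnectedComponent.mem_supp_iff,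
    SimpleGraph.ConnectedComponent.mem_supp_iff,
    SimpleGraph.ConnectedComponent.eq.2 (H.reachable_a_b hw)]

theorem finrank_cutFun [Finite U] (S : Set W) :
    Module.finrank K (H.cutFun K S) = Nat.card (H.cut S).ConnectedComponent := by
  have := Fintype.ofFinite (H.cut S).ConnectedComponent
  have range_eq : LinearMap.range (LinearMap.funLeft K K (H.cut S).connectedComponentMk) =
      H.cutFun K S := by
    ext f
    constructor
    · rintro ⟨g, rfl⟩ w hw
      exact sub_eq_zero.2 (congrArg g (SimpleGraph.ConnectedComponent.eq.2 (H.reachable_a_b hw)))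
    · exact fun hf => ⟨fun C => f C.out, funext fun x => H.apply_eq_of_reachable hf
        (SimpleGraph.ConnectedComponent.eq.1 (Quot.out_eq _))⟩
  rw [← range_eq, LinearMap.finrank_range_of_inj
    (LinearMap.funLeft_injective_of_surjective K K (H.cut S).connectedComponentMk
      Quot.mk_surjective),
    Module.finrank_fintype_fun_eq_card, Nat.card_eq_fintype_card]

theorem not_isBoundary_of_connected {C : Set W} (hne : C.Nonempty) (hC : (H.cut C).Connected) :
    ¬ H.IsBoundary K C := by
  rintro ⟨f, hf⟩
  obtain ⟨w, hw⟩ := hne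
  have hmem : f ∈ H.cutFun K C := fun w hw => by rw [hf, Set.indicator_of_notMem hw]
  have hw0 : H.grad K f w = 0 :=
    sub_eq_zero.2 (H.apply_eq_of_reachable hmem (hC.preconnected _ _))
  rw [hf, Set.indicator_of_mem hw] at hw0
  exact one_ne_zero hw0

/-- The Euler formula for the graph without the edges in `S`. -/
theorem finrank_flows_add [Fintype W] [Finite U] (S : Set W) :
    Module.finrank K (H.flows K S) + S.ncard + Nat.card U =
      Module.finrank K (H.cutFun K S) + Nat.card W := by
  classical
  let restrict : (W → K) →ₗ[K] ((Sᶜ : Set W) → K) := LinearMap.funLeft K K Subtype.val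
  have ker_eq : LinearMap.ker (restrict ∘ₗ H.grad K) = H.cutFun K S := by
    ext f
    exact ⟨fun hf w hw => congrFun hf ⟨w, hw⟩, fun hf => funext fun w => hf w w.2⟩
  have dot_restrict {φ ψ : W → K} (hφ : ∀ w ∈ S, φ w = 0) :
      restrict φ ⬝ᵥ restrict ψ = φ ⬝ᵥ ψ :=
    Fintype.sum_of_injective Subtype.val Subtype.val_injective _ _
      (fun w hw => by rw [hφ w (by simpa using hw), zero_mul]) fun _ => rfl
  have restrict_injective : Injective (restrict.domRestrict (H.flows K S)) := by
    rw [injective_iff_map_eq_zero]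
    rintro ⟨φ, hφ⟩ h0
    ext w
    by_cases hw : w ∈ S
    exacts [hφ.1 w hw, congrFun h0 ⟨w, hw⟩]
  have range_eq : LinearMap.range (restrict.domRestrict (H.flows K S)) =
      LinearMap.BilinForm.orthogonal (dotProductBilin K K)
        (LinearMap.range (restrict ∘ₗ H.grad K)) := by
    ext φ
    constructor
    · rintro ⟨⟨φ, hφ⟩, rfl⟩ _ ⟨f, rfl⟩
      exact (dotProduct_comm _ _).trans ((dot_restrict hφ.1).trans (hφ.2 f))
    · intro hφ
      let ψ : W → K := fun w => if h : w ∈ S then 0 else φ ⟨w, h⟩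
      have hψ : ∀ w ∈ S, ψ w = 0 := fun w hw => dif_pos hw
      have restrict_ψ : restrict ψ = φ := funext fun w => dif_neg w.2
      refine ⟨⟨ψ, hψ, fun f => ?_⟩, restrict_ψ⟩
      rw [← dot_restrict hψ, restrict_ψ, dotProduct_comm]
      exact hφ _ ⟨f, rfl⟩
  have rank := finrank_orthogonal_range_add (restrict ∘ₗ H.grad K)
  have compl := S.ncard_add_ncard_compl
  rw [← range_eq, LinearMap.finrank_range_of_inj restrict_injective, ker_eq,
    Module.finrank_eq_nat_card_basis (Pi.basisFun K U), Nat.card_coe_set_eq] at rank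
  omega

end Gradient

end BipartiteMap

/-! ### Existence of nonseparating sections -/

namespace BipartiteMap

variable {W X U : Type*} (H : BipartiteMap W X U) {K : Type*} [Field K] {f : U → K} {s : X → W}
  {v : X}

theorem orbitEdges_subset_range (v : X) : H.orbitEdges s v ⊆ Set.range s :=
  Set.image_subset_range _ _

section Balance

theorem sum_grad_hd_eq_sum_grad_tl [Fintype W] [DecidableEq X] (f : U → K) (v : X) :
    ∑ w with H.hd w = v, H.grad K f w = ∑ w with H.tl w = v, H.grad K f w := by
  simp only [grad_apply, Finset.sum_sub_distrib, Finset.sum_filter]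
  congr 1
  · rw [← Equiv.sum_comp H.ε]
    exact Finset.sum_congr rfl fun w _ => by rw [a_ε, tl]
  · rw [← Equiv.sum_comp H.δ]
    exact Finset.sum_congr rfl fun w _ => by rw [b_δ, hd_δ, tl]

theorem sum_grad_section_eq [Fintype X] [DecidableEq X] [Finite W] (hs : LeftInverse H.hd s)
    (hf : f ∈ H.cutFun K (Set.range s)) (v : X) :
    ∑ u with H.pred s u = v, H.grad K f (s u) = H.grad K f (s v) := by
  have := Fintype.ofFinite W
  have sum_section (j : W → X) :
      ∑ u with j (s u) = v, H.grad K f (s u) = ∑ w with j w = v, H.grad K f w := by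
    rw [Finset.sum_filter, Finset.sum_filter]
    exact Fintype.sum_of_injective s hs.injective _ _
      (fun w hw => by rw [hf w hw, ite_self]) fun _ => rfl
  have h := H.sum_grad_hd_eq_sum_grad_tl f v
  rw [← sum_section, ← sum_section] at h
  simp only [hs _, Finset.sum_filter, Finset.sum_ite_eq', Finset.mem_univ, if_true] at h
  rw [Finset.sum_filter]
  exact h.symm

variable [Finite W] [Finite X]

theorem grad_section_eq_zero (hs : LeftInverse H.hd s) (hf : f ∈ H.cutFun K (Set.range s))
    (hv : v ∉ periodicPts (H.pred s)) : H.grad K f (s v) = 0 := by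
  classical
  have := Fintype.ofFinite X
  exact eq_zero_of_fibre_sum_eq (g := fun v => H.grad K f (s v)) (H.sum_grad_section_eq hs hf) hv

theorem grad_section_eq_of_mem_forwardOrbit (hs : LeftInverse H.hd s)
    (hf : f ∈ H.cutFun K (Set.range s)) (hv : v ∈ periodicPts (H.pred s)) {u : X}
    (hu : u ∈ forwardOrbit (H.pred s) v) : H.grad K f (s u) = H.grad K f (s v) := by
  classical
  have := Fintype.ofFinite X
  exact apply_eq_of_fibre_sum_eq_of_mem_forwardOrbit (g := fun v => H.grad K f (s v))
    (H.sum_grad_section_eq hs hf) hv hu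

theorem isBoundary_orbitEdges (hs : LeftInverse H.hd s) (hv : v ∈ periodicPts (H.pred s))
    (hf : f ∈ H.cutFun K (H.orbitEdges s v)) (hne : H.grad K f (s v) ≠ 0) :
    H.IsBoundary K (H.orbitEdges s v) := by
  have hf' := H.cutFun_mono (H.orbitEdges_subset_range v) hf
  refine ⟨(H.grad K f (s v))⁻¹ • f, funext fun w => ?_⟩
  rw [map_smul, Pi.smul_apply, smul_eq_mul]
  by_cases hw : w ∈ H.orbitEdges s v
  · rw [Set.indicator_of_mem hw]
    obtain ⟨u, hu, rfl⟩ := hw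
    rw [H.grad_section_eq_of_mem_forwardOrbit hs hf' hv hu, inv_mul_cancel₀ hne, Pi.one_apply]
  · rw [Set.indicator_of_notMem hw, hf w hw, mul_zero]

theorem isBoundary_of_not_connected (hs : LeftInverse H.hd s) (hv : v ∈ periodicPts (H.pred s))
    (h : ¬ (H.cut (H.orbitEdges s v)).Connected) : H.IsBoundary K (H.orbitEdges s v) := by
  have := H.nonempty_vertices
  rw [SimpleGraph.connected_iff, and_iff_left ‹Nonempty U›, SimpleGraph.Preconnected] at h
  push Not at h
  obtain ⟨x, y, hxy⟩ := h
  let C := (H.cut (H.orbitEdges s v)).connectedComponentMk x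
  let f : U → K := C.supp.indicator 1
  have hf : f ∈ H.cutFun K (H.orbitEdges s v) := H.indicator_supp_mem_cutFun C
  refine H.isBoundary_orbitEdges hs hv hf fun hv0 => ?_
  have grad_eq_zero : H.grad K f = 0 := funext fun w => by
    by_cases hw : w ∈ H.orbitEdges s v
    · obtain ⟨u, hu, rfl⟩ := hw
      rw [H.grad_section_eq_of_mem_forwardOrbit hs
        (H.cutFun_mono (H.orbitEdges_subset_range v) hf) hv hu, hv0, Pi.zero_apply]
    · exact hf w hw
  have hfx : f x = 1 := Set.indicator_of_mem (show x ∈ C.supp from rfl) _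
  have hfy : f y = 0 := Set.indicator_of_notMem
    (fun hy : y ∈ C.supp => hxy (SimpleGraph.ConnectedComponent.eq.1 hy).symm) _
  exact one_ne_zero (hfx.symm.trans ((H.apply_eq_of_grad_eq_zero grad_eq_zero x y).trans hfy))

end Balance

section Existence

theorem exists_flow_notMem_range_cograd [Fintype W] [Finite X] [Finite U] (hH : H.IsToric) :
    ∃ φ ∈ H.flows K ∅, φ ∉ LinearMap.range (H.cograd K) := by
  have := Fintype.ofFinite X
  by_contra! hle
  have finrank_le := Submodule.finrank_mono hle
  have rank_nullity := LinearMap.finrank_range_add_finrank_ker (H.cograd K)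
  have euler := H.finrank_flows_add (K := K) ∅
  have ker_pos : 0 < Module.finrank K (LinearMap.ker (H.cograd K)) := by
    obtain ⟨w⟩ := H.nonempty
    refine Module.finrank_pos_iff_exists_ne_zero.2 ⟨⟨1, ?_⟩, fun h => ?_⟩
    · exact funext fun _ => sub_self (1 : K)
    · exact one_ne_zero (congrFun (congrArg Subtype.val h) (H.hd w))
  have components_pos : 0 < Nat.card (H.cut ∅).ConnectedComponent := by
    have := H.nonempty_vertices.map (H.cut ∅).connectedComponentMk
    exact Nat.card_pos
  rw [Set.ncard_empty, finrank_cutFun] at euler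
  rw [Module.finrank_fintype_fun_eq_card, ← Nat.card_eq_fintype_card] at rank_nullity
  rw [IsToric] at hH
  omega

theorem sum_orbit_eq_zero_of_isBoundary [Fintype W] (hs : LeftInverse H.hd s)
    (hv : v ∈ periodicPts (H.pred s))
    (hbd : H.IsBoundary K (H.orbitEdges s v)) {φ : W → K} (hφ : φ ∈ H.flows K ∅) :
    ∑ j ∈ Finset.range (minimalPeriod (H.pred s) v), φ (s ((H.pred s)^[j] v)) = 0 := by
  classical
  obtain ⟨g, hg⟩ := hbd
  let O := (Finset.range (minimalPeriod (H.pred s) v)).image fun j => s ((H.pred s)^[j] v)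
  have injOn : Set.InjOn (fun j => s ((H.pred s)^[j] v))
      (Finset.range (minimalPeriod (H.pred s) v)) := fun i hi j hj hij =>
    iterate_injOn_Iio_minimalPeriod (by simpa using hi) (by simpa using hj) (hs.injective hij)
  have orbitEdges_eq : H.orbitEdges s v = O := by
    rw [orbitEdges, forwardOrbit_eq_image_range hv, ← Finset.coe_image, Finset.image_image]
    rfl
  calc ∑ j ∈ Finset.range (minimalPeriod (H.pred s) v), φ (s ((H.pred s)^[j] v))
      = ∑ w ∈ O, φ w := (Finset.sum_image injOn).symm
    _ = φ ⬝ᵥ (O : Set W).indicator 1 := by simp [dotProduct, Set.indicator_apply]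
    _ = 0 := by rw [← orbitEdges_eq, ← hg, hφ.2]

theorem mem_range_cograd_of_apply_hd_eq {φ : W → ZMod 2} {f : X → ℝ} (hf0 : ∀ v, f v ≠ 0)
    (hf : ∀ w, f (H.hd w) = (-1) ^ (φ w).val * f (H.tl w)) :
    φ ∈ LinearMap.range (H.cograd (ZMod 2)) := by
  refine ⟨fun v => if f v < 0 then 1 else 0, funext fun w => ?_⟩
  rw [cograd_apply]
  have two (t : ZMod 2) : t = 0 ∨ t = 1 := by revert t; decide
  obtain h0 | h1 := two (φ w)
  · simp [hf w, h0]
  · rcases lt_or_gt_of_ne (hf0 (H.tl w)) with h | h <;>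
      simp [hf w, h1, ZMod.val_one, h, not_lt.2 h.le]

variable [DecidableEq X]

/-- The contribution of the dual edge across `w` to the twisted Laplacian. -/
def twistedRow (τ : W → ℝ) (w : W) : X → ℝ := Pi.single (H.hd w) 1 - Pi.single (H.tl w) (τ w)

theorem twistedRow_dotProduct [Fintype X] (τ : W → ℝ) (w : W) (f : X → ℝ) :
    H.twistedRow τ w ⬝ᵥ f = f (H.hd w) - τ w * f (H.tl w) := by
  rw [twistedRow, sub_dotProduct, single_dotProduct, single_dotProduct, one_mul]

theorem det_section_eq_zero [Fintype X] {τ : W → ℝ} (hs : LeftInverse H.hd s)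
    (hv : v ∈ periodicPts (H.pred s))
    (hτ : ∏ j ∈ Finset.range (minimalPeriod (H.pred s) v), τ (s ((H.pred s)^[j] v)) = 1) :
    (Matrix.of fun v => H.twistedRow τ (s v)).det = 0 := by
  have h := det_single_sub_single_eq_zero (H.pred s) (fun v => τ (s v)) hv hτ
  simpa only [twistedRow, hs _, pred] using h

variable [Fintype W]

/-- The Laplacian of the dual graph whose edges carry the weights `τ`; it sums over the dual edges
that point to a face. -/
def twistedLaplacian (τ : W → ℝ) : Matrix X X ℝ :=
  Matrix.of fun v => ∑ w with H.hd w = v, H.twistedRow τ w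

variable [Fintype X]

/-- Every face is the head of as many dual edges as it is the tail of, so the quadratic form of
the Laplacian is a sum of squares. -/
theorem sum_sq_eq_dotProduct_twistedLaplacian {τ : W → ℝ} (hτ : ∀ w, |τ w| = 1) (f : X → ℝ) :
    ∑ w, (f (H.hd w) - τ w * f (H.tl w)) ^ 2 = 2 * (f ⬝ᵥ (H.twistedLaplacian τ).mulVec f) := by
  have tl_eq_hd : ∑ w, f (H.tl w) ^ 2 = ∑ w, f (H.hd w) ^ 2 :=
    Equiv.sum_comp H.ε fun w => f (H.hd w) ^ 2
  have form_eq : f ⬝ᵥ (H.twistedLaplacian τ).mulVec f =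
      ∑ w, f (H.hd w) * (f (H.hd w) - τ w * f (H.tl w)) := by
    rw [← Finset.sum_fiberwise Finset.univ H.hd]
    refine Finset.sum_congr rfl fun v _ => ?_
    simp only [Matrix.mulVec, twistedLaplacian, Matrix.of_apply, sum_dotProduct,
      twistedRow_dotProduct, Finset.mul_sum]
    exact Finset.sum_congr rfl fun w hw => by rw [(Finset.mem_filter.1 hw).2]
  have expand (w : W) : (f (H.hd w) - τ w * f (H.tl w)) ^ 2 =
      2 * (f (H.hd w) * (f (H.hd w) - τ w * f (H.tl w))) +
        (f (H.tl w) ^ 2 - f (H.hd w) ^ 2) := by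
    have hτ2 : τ w ^ 2 = 1 := by rw [← sq_abs, hτ, one_pow]
    linear_combination f (H.tl w) ^ 2 * hτ2
  rw [Finset.sum_congr rfl fun w _ => expand w, Finset.sum_add_distrib, Finset.sum_sub_distrib,
    tl_eq_hd, sub_self, add_zero, ← Finset.mul_sum, form_eq]

theorem exists_apply_hd_eq_mul_apply_tl {τ : W → ℝ} (hτ : ∀ w, |τ w| = 1)
    (hdet : (H.twistedLaplacian τ).det = 0) :
    ∃ f : X → ℝ, (∀ v, f v ≠ 0) ∧ ∀ w, f (H.hd w) = τ w * f (H.tl w) := by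
  obtain ⟨f, hf0, hf⟩ := Matrix.exists_mulVec_eq_zero_iff.2 hdet
  have harmonic (w : W) : f (H.hd w) = τ w * f (H.tl w) := by
    have sum_eq_zero := H.sum_sq_eq_dotProduct_twistedLaplacian hτ f
    rw [hf, dotProduct_zero, mul_zero, Finset.sum_eq_zero_iff_of_nonneg fun w _ => sq_nonneg _]
      at sum_eq_zero
    exact sub_eq_zero.1 (pow_eq_zero_iff two_ne_zero |>.1 (sum_eq_zero w (Finset.mem_univ w)))
  have abs_eq (w : W) : |f (H.hd w)| = |f (H.hd (H.ε w))| := by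
    rw [harmonic, abs_mul, hτ, one_mul, tl]
  have abs_const (w w' : W) : |f (H.hd w)| = |f (H.hd w')| :=
    H.apply_eq_of_invariant (F := fun w => |f (H.hd w)|) (fun w => by rw [hd_δ, abs_eq w])
      (fun w => (abs_eq w).symm) w w'
  refine ⟨f, fun v hv => hf0 (funext fun u => ?_), harmonic⟩
  obtain ⟨w, rfl⟩ := H.hd_surjective v
  obtain ⟨w', rfl⟩ := H.hd_surjective u
  rw [Pi.zero_apply, ← abs_eq_zero, abs_const w' w, hv, abs_zero]

theorem exists_section_det_ne_zero {τ : W → ℝ} (hdet : (H.twistedLaplacian τ).det ≠ 0) :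
    ∃ s : X → W, LeftInverse H.hd s ∧ (Matrix.of fun v => H.twistedRow τ (s v)).det ≠ 0 := by
  have expansion : (H.twistedLaplacian τ).det =
      ∑ s ∈ Fintype.piFinset fun v => {w | H.hd w = v},
        (Matrix.of fun v => H.twistedRow τ (s v)).det :=
    MultilinearMap.map_sum_finset (Matrix.detRowAlternating (n := X) (R := ℝ)).toMultilinearMap
      (fun _ w => H.twistedRow τ w) _
  rw [expansion] at hdet
  obtain ⟨s, hs, hne⟩ := Finset.exists_ne_zero_of_sum_ne_zero hdet
  exact ⟨s, fun v => (Finset.mem_filter.1 (Fintype.mem_piFinset.1 hs v)).2, hne⟩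

end Existence

theorem exists_isNonseparating_section [Finite W] [Finite X] [Finite U] (hH : H.IsToric) :
    ∃ s : X → W, LeftInverse H.hd s ∧ H.IsNonseparating s := by
  classical
  have := Fintype.ofFinite W
  have := Fintype.ofFinite X
  obtain ⟨φ, hφ, hnot⟩ := H.exists_flow_notMem_range_cograd (K := ZMod 2) hH
  let χ : AddChar (ZMod 2) ℝ := AddChar.zmodChar 2 (ζ := (-1 : ℝ)) (by norm_num)
  have abs_χ (w : W) : |χ (φ w)| = 1 := by
    rw [AddChar.zmodChar_apply, abs_pow, abs_neg, abs_one, one_pow]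
  have det_ne_zero : (H.twistedLaplacian (χ ∘ φ)).det ≠ 0 := fun h => by
    obtain ⟨f, hf0, hf⟩ := H.exists_apply_hd_eq_mul_apply_tl abs_χ h
    exact hnot (H.mem_range_cograd_of_apply_hd_eq hf0 hf)
  obtain ⟨s, hs, hdet⟩ := H.exists_section_det_ne_zero det_ne_zero
  refine ⟨s, hs, fun v hv => of_not_not fun hcon => hdet (H.det_section_eq_zero hs hv ?_)⟩
  have hbd := H.isBoundary_of_not_connected (K := ZMod 2) hs hv hcon
  calc ∏ j ∈ Finset.range (minimalPeriod (H.pred s) v), χ (φ (s ((H.pred s)^[j] v)))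
      = χ (∑ j ∈ Finset.range (minimalPeriod (H.pred s) v), φ (s ((H.pred s)^[j] v))) :=
        (map_prod χ.toMonoidHom
          (fun j => Multiplicative.ofAdd (φ (s ((H.pred s)^[j] v)))) _).symm
    _ = 1 := by rw [H.sum_orbit_eq_zero_of_isBoundary hs hv hbd hφ, AddChar.map_zero_eq_one]

end BipartiteMap

/-! ### Components and cycles of the complement of a nonseparating section -/

namespace BipartiteMap

variable {W X U : Type*} (H : BipartiteMap W X U) {K : Type*} [Field K] {s : X → W} {v : X}

section Cycles

theorem IsNonseparating.not_isBoundary {H : BipartiteMap W X U} (hns : H.IsNonseparating s)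
    (hv : v ∈ periodicPts (H.pred s)) : ¬ H.IsBoundary K (H.orbitEdges s v) :=
  H.not_isBoundary_of_connected (Set.Nonempty.image s ⟨v, self_mem_forwardOrbit _ v⟩) (hns v hv)

variable [Finite W] [Finite X]

theorem mem_cutFun_orbitEdges {f : U → K} (hs : LeftInverse H.hd s)
    (hf : f ∈ H.cutFun K (Set.range s))
    (h : ∀ u ∈ periodicPts (H.pred s), u ∉ forwardOrbit (H.pred s) v → H.grad K f (s u) = 0) :
    f ∈ H.cutFun K (H.orbitEdges s v) := fun w hw => by
  by_cases hwS : w ∈ Set.range s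
  · obtain ⟨u, rfl⟩ := hwS
    by_cases hu : u ∈ periodicPts (H.pred s)
    · exact h u hu fun hmem => hw (Set.mem_image_of_mem s hmem)
    · exact H.grad_section_eq_zero hs hf hu
  · exact hf w hwS

theorem grad_eq_zero_of_forall_periodicPts {f : U → K} (hs : LeftInverse H.hd s)
    (hf : f ∈ H.cutFun K (Set.range s))
    (h : ∀ u ∈ periodicPts (H.pred s), H.grad K f (s u) = 0) : H.grad K f = 0 := funext fun w => by
  by_cases hw : w ∈ H.orbitEdges s (H.hd w)
  · obtain ⟨u, -, rfl⟩ := hw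
    by_cases hu : u ∈ periodicPts (H.pred s)
    exacts [h u hu, H.grad_section_eq_zero hs hf hu]
  · exact H.mem_cutFun_orbitEdges hs hf (fun u hu _ => h u hu) w hw

theorem exists_grad_section_ne_indicator_basin {f : U → K} (hs : LeftInverse H.hd s)
    (hns : H.IsNonseparating s) (hf : f ∈ H.cutFun K (Set.range s))
    (hv : v ∈ periodicPts (H.pred s)) :
    ∃ u ∈ periodicPts (H.pred s), H.grad K f (s u) ≠ (basin (H.pred s) v).indicator 1 u := by
  by_contra! grad_eq
  refine hns.not_isBoundary (K := K) hv (H.isBoundary_orbitEdges hs hv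
    (H.mem_cutFun_orbitEdges hs hf fun u hu hnot => ?_) ?_)
  · rw [grad_eq u hu, Set.indicator_of_notMem fun h => hnot (mem_forwardOrbit_of_mem_basin hu h)]
  · rw [grad_eq v hv, Set.indicator_of_mem (self_mem_basin _ v)]
    exact one_ne_zero

theorem finrank_cutFun_le_finrank_invariantFun [Finite U] (hs : LeftInverse H.hd s)
    (hns : H.IsNonseparating s) :
    Module.finrank K (H.cutFun K (Set.range s)) ≤
      Module.finrank K (invariantFun K (H.pred s)) := by
  obtain ⟨n, hn⟩ := exists_iterate_mem_periodicPts (H.pred s)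
  have surj_on_periodic {u : X} (hu : u ∈ periodicPts (H.pred s)) : ∃ t, (H.pred s)^[n] t = u := by
    obtain ⟨t, -, ht⟩ := ((bijOn_periodicPts (H.pred s)).iterate n).surjOn hu
    exact ⟨t, ht⟩
  let jump : H.cutFun K (Set.range s) →ₗ[K] (X → K) :=
    (LinearMap.funLeft K K (s ∘ (H.pred s)^[n]) ∘ₗ H.grad K).domRestrict _
  obtain ⟨w₀⟩ := H.nonempty
  have range_lt : LinearMap.range jump < invariantFun K (H.pred s) := by
    refine lt_of_le_of_ne ?_ fun heq => ?_
    · rintro _ ⟨f, rfl⟩ v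
      exact (congrArg _ (congrArg s ((iterate_succ_apply _ n v).symm.trans
        (iterate_succ_apply' _ n v)))).trans
        (H.grad_section_eq_of_mem_forwardOrbit hs f.2 (hn v) ⟨1, rfl⟩)
    · have hmem := indicator_basin_mem_invariantFun K (H.pred s) ((H.pred s)^[n] (H.hd w₀))
      obtain ⟨f, hf⟩ := heq.symm ▸ hmem
      obtain ⟨u, hu, hne⟩ := H.exists_grad_section_ne_indicator_basin hs hns f.2 (hn (H.hd w₀))
      obtain ⟨t, rfl⟩ := surj_on_periodic hu
      rw [invariantFun_apply_iterate hmem, ← hf] at hne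
      exact hne rfl
  have ker_le : (LinearMap.ker jump).map (H.cutFun K (Set.range s)).subtype ≤
      Submodule.span K {1} := by
    rintro _ ⟨f, hf, rfl⟩
    have grad_eq_zero : H.grad K f.1 = 0 :=
      H.grad_eq_zero_of_forall_periodicPts hs f.2 fun u hu => by
        obtain ⟨t, rfl⟩ := surj_on_periodic hu
        exact congrFun (LinearMap.mem_ker.1 hf) t
    refine Submodule.mem_span_singleton.2 ⟨f.1 (H.a w₀), funext fun x => ?_⟩
    rw [Pi.smul_apply, Pi.one_apply, smul_eq_mul, mul_one]
    exact H.apply_eq_of_grad_eq_zero grad_eq_zero _ _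
  have := H.nonempty_vertices
  have h1 := Submodule.finrank_lt_finrank_of_lt range_lt
  have h2 := LinearMap.finrank_range_add_finrank_ker jump
  have h3 := Submodule.finrank_mono ker_le
  rw [Submodule.finrank_map_subtype_eq, finrank_span_singleton one_ne_zero] at h3
  omega

end Cycles

end BipartiteMap

namespace BipartiteMap

variable {W X U : Type*} (H : BipartiteMap W X U) (K : Type*) [Field K] {s : X → W} {v : X}

/-- Pairs of functions on the corners of the graph that are constant along the boundary of a
neighbourhood of the dual edges in `S` and the faces. The two entries at `w` stand for the corners
between `w` and its predecessors `ε⁻¹ w` and `δ⁻¹ w` at its two ends. Thus `w` and the entries `w`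
lie on the same side, and the corners on the other side of `w` are those at `ε w` and `δ w`. -/
def sideFun (S : Set W) : Submodule K ((W → K) × (W → K)) where
  carrier := {L | (∀ w ∉ S, L.1 w = L.2 w ∧ L.1 (H.ε w) = L.2 (H.δ w)) ∧
    ∀ w ∈ S, L.1 w = L.1 (H.ε w) ∧ L.2 w = L.2 (H.δ w)}
  add_mem' hL hM :=
    ⟨fun w hw => ⟨congrArg₂ (· + ·) (hL.1 w hw).1 (hM.1 w hw).1,
      congrArg₂ (· + ·) (hL.1 w hw).2 (hM.1 w hw).2⟩,
    fun w hw => ⟨congrArg₂ (· + ·) (hL.2 w hw).1 (hM.2 w hw).1,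
      congrArg₂ (· + ·) (hL.2 w hw).2 (hM.2 w hw).2⟩⟩
  zero_mem' := ⟨fun _ _ => ⟨rfl, rfl⟩, fun _ _ => ⟨rfl, rfl⟩⟩
  smul_mem' r _ hL :=
    ⟨fun w hw => ⟨congrArg (r * ·) (hL.1 w hw).1, congrArg (r * ·) (hL.1 w hw).2⟩,
    fun w hw => ⟨congrArg (r * ·) (hL.2 w hw).1, congrArg (r * ·) (hL.2 w hw).2⟩⟩

variable {K} {S : Set W} {D E : W → K}

theorem comp_mem_sideFun {f : U → K} (hf : f ∈ H.cutFun K S) :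
    (f ∘ H.a, f ∘ H.b) ∈ H.sideFun K S := by
  refine ⟨fun w hw => ⟨H.apply_a_eq_apply_b hf hw, ?_⟩, fun w _ => ?_⟩
  · simp only [comp_apply, a_ε, b_δ, H.apply_a_eq_apply_b hf hw]
  · simp only [comp_apply, a_ε, b_δ, and_self]

theorem mul_mem_sideFun {p : X → K} (hs : LeftInverse H.hd s)
    (hp : p ∈ invariantFun K (H.pred s)) (h : (D, E) ∈ H.sideFun K (Set.range s)) :
    (p ∘ H.hd * D, p ∘ H.hd * E) ∈ H.sideFun K (Set.range s) := by
  refine ⟨fun w hw => ?_, ?_⟩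
  · simp only [Pi.mul_apply, comp_apply, hd_δ]
    exact ⟨congrArg (p _ * ·) (h.1 w hw).1, congrArg (p _ * ·) (h.1 w hw).2⟩
  · rintro _ ⟨u, rfl⟩
    have hpu : p (H.hd (H.ε (s u))) = p u := hp u
    have h' := h.2 (s u) ⟨u, rfl⟩
    simp only [Pi.mul_apply, comp_apply, hd_δ, hs u, hpu]
    exact ⟨congrArg (p u * ·) h'.1, congrArg (p u * ·) h'.2⟩

theorem sub_comp_mem_flows [Fintype W] (h : (D, E) ∈ H.sideFun K S) :
    D - D ∘ H.ε ∈ H.flows K S := by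
  refine ⟨fun w hw => sub_eq_zero.2 (h.2 w hw).1, fun f => ?_⟩
  have sub_eq (w : W) : D w - D (H.ε w) = E w - E (H.δ w) := by
    by_cases hw : w ∈ S
    · exact (sub_eq_zero.2 (h.2 w hw).1).trans (sub_eq_zero.2 (h.2 w hw).2).symm
    · exact congrArg₂ _ (h.1 w hw).1 (h.1 w hw).2
  have telescope (w : W) : (D - D ∘ H.ε) w * H.grad K f w =
      (D w * f (H.a w) - D (H.ε w) * f (H.a (H.ε w))) -
        (E w * f (H.b w) - E (H.δ w) * f (H.b (H.δ w))) := by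
    rw [a_ε, b_δ, Pi.sub_apply, comp_apply, grad_apply]
    linear_combination (-f (H.b w)) * sub_eq w
  rw [dotProduct, Finset.sum_congr rfl fun w _ => telescope w]
  simp only [Finset.sum_sub_distrib]
  rw [Equiv.sum_comp H.ε fun w => D w * f (H.a w), Equiv.sum_comp H.δ fun w => E w * f (H.b w),
    sub_self, sub_self, sub_self]

theorem exists_eq_comp_of_mem_sideFun (h : (D, E) ∈ H.sideFun K S) (hD : D - D ∘ H.ε = 0) :
    ∃ f ∈ H.cutFun K S, f ∘ H.a = D ∧ f ∘ H.b = E := by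
  have D_ε (w : W) : D (H.ε w) = D w := (sub_eq_zero.1 (congrFun hD w)).symm
  have E_δ (w : W) : E (H.δ w) = E w := by
    by_cases hw : w ∈ S
    · exact (h.2 w hw).2.symm
    · exact (h.1 w hw).2.symm.trans ((D_ε w).trans (h.1 w hw).1)
  obtain ⟨f, hfa, hfb⟩ := H.exists_apply_a_eq_apply_b_eq D_ε E_δ
  refine ⟨f, fun w hw => ?_, funext hfa, funext hfb⟩
  rw [grad_apply, hfa, hfb, sub_eq_zero]
  exact (h.1 w hw).1

theorem finrank_sideFun_le [Fintype W] [Finite U] (S : Set W) :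
    Module.finrank K (H.sideFun K S) ≤
      Module.finrank K (H.flows K S) + Module.finrank K (H.cutFun K S) := by
  let jump : (W → K) × (W → K) →ₗ[K] (W → K) :=
    LinearMap.fst K _ _ - LinearMap.funLeft K K H.ε ∘ₗ LinearMap.fst K _ _
  let corners : (U → K) →ₗ[K] (W → K) × (W → K) :=
    (LinearMap.funLeft K K H.a).prod (LinearMap.funLeft K K H.b)
  have range_le : LinearMap.range (jump.domRestrict (H.sideFun K S)) ≤ H.flows K S := by
    rintro _ ⟨⟨⟨D, E⟩, h⟩, rfl⟩
    exact H.sub_comp_mem_flows h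
  have ker_le : (LinearMap.ker (jump.domRestrict (H.sideFun K S))).map
      (H.sideFun K S).subtype ≤ (H.cutFun K S).map corners := by
    rintro _ ⟨⟨⟨D, E⟩, h⟩, h0, rfl⟩
    obtain ⟨f, hf, rfl, rfl⟩ := H.exists_eq_comp_of_mem_sideFun h (LinearMap.mem_ker.1 h0)
    exact ⟨f, hf, rfl⟩
  rw [← LinearMap.finrank_range_add_finrank_ker (jump.domRestrict (H.sideFun K S)),
    ← Submodule.finrank_map_subtype_eq]
  exact add_le_add (Submodule.finrank_mono range_le)
    ((Submodule.finrank_mono ker_le).trans (Submodule.finrank_map_le _ _))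

/-- Around a face, the left-hand sides of the cycles through it form an arc. -/
theorem exists_sub_eq_indicator_sub_indicator [Finite W] [Finite X] (hs : LeftInverse H.hd s)
    (x : X) :
    let ζ : W → K := (s '' periodicPts (H.pred s)).indicator 1
    ∃ u : W → K, (∀ w, H.tl w = x → u (H.δ w) - u (H.ε w) = ζ (H.δ w) - ζ w) ∧
      (x ∈ periodicPts (H.pred s) → u (s x) = 1) ∧
      ∀ v ∈ periodicPts (H.pred s), H.pred s v = x → u (H.ε (s v)) = 1 := by
  classical
  intro ζ
  have ζ_eq_zero {w : W} (h : ∀ v ∈ periodicPts (H.pred s), s v ≠ w) : ζ w = 0 :=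
    Set.indicator_of_notMem (by rintro ⟨v, hv, hvw⟩; exact h v hv hvw) _
  have ζ_eq_one {v : X} (hv : v ∈ periodicPts (H.pred s)) : ζ (s v) = 1 :=
    Set.indicator_of_mem (Set.mem_image_of_mem s hv) _
  by_cases hx : x ∈ periodicPts (H.pred s)
  · obtain ⟨v, hv, rfl⟩ := (bijOn_periodicPts (H.pred s)).surjOn hx
    obtain ⟨u, hu, hp, hq⟩ := exists_sub_eq_single_sub_single (R := K)
      ((H.hd_eq_iff (s (H.pred s v)) (H.ε (s v))).1 (hs _))
    refine ⟨u, fun w hw => ?_, fun _ => hp, fun t ht htv => ?_⟩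
    · have hδ : ζ (H.δ w) = if H.δ w = s (H.pred s v) then 1 else 0 := by
        split_ifs with h
        · rw [h, ζ_eq_one hx]
        · refine ζ_eq_zero fun t _ ht => h ?_
          rw [← ht, ← hw, tl, ← hd_δ, ← ht, hs]
      have hε : ζ w = if H.ε w = H.ε (s v) then 1 else 0 := by
        split_ifs with h
        · rw [H.ε.injective h, ζ_eq_one hv]
        · refine ζ_eq_zero fun t ht htw => h ?_
          subst htw
          rw [(bijOn_periodicPts (H.pred s)).injOn ht hv hw]
      have := hu (H.ε w)
      rwa [Equiv.Perm.mul_apply, Equiv.Perm.coe_inv, Equiv.symm_apply_apply, ← hδ, ← hε] at this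
    · rw [(bijOn_periodicPts (H.pred s)).injOn ht hv htv, hq]
  · have pred_ne {v : X} (hv : v ∈ periodicPts (H.pred s)) : H.pred s v ≠ x := fun h =>
      hx (h ▸ (bijOn_periodicPts (H.pred s)).mapsTo hv)
    refine ⟨0, fun w hw => ?_, fun h => absurd h hx, fun v hv h => absurd h (pred_ne hv)⟩
    have hδ : ζ (H.δ w) = 0 := ζ_eq_zero fun v hv h => hx (by rwa [← hw, tl, ← hd_δ, ← h, hs])
    have hε : ζ w = 0 := ζ_eq_zero fun v hv h => pred_ne hv ((congrArg H.tl h).trans hw)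
    rw [hδ, hε, Pi.zero_apply, Pi.zero_apply]

/-- Some corner function jumps by one exactly when the cycles of `s` are crossed. -/
theorem exists_mem_sideFun_sub_eq_one [Finite W] [Finite X] (hs : LeftInverse H.hd s) :
    ∃ D E : W → K, (D, E) ∈ H.sideFun K (Set.range s) ∧
      ∀ v ∈ periodicPts (H.pred s), D (s v) - E (s v) = 1 := by
  choose arc arc_sub arc_s arc_ε using H.exists_sub_eq_indicator_sub_indicator (K := K) hs
  set ζ : W → K := (s '' periodicPts (H.pred s)).indicator 1
  let u (w : W) : K := arc (H.hd w) w
  have u_sub (w : W) : u (H.δ w) - u (H.ε w) = ζ (H.δ w) - ζ w := by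
    simp only [u, hd_δ, ← arc_sub _ w rfl]
    rfl
  have u_eq (v : X) (hv : v ∈ periodicPts (H.pred s)) : u (H.ε (s v)) - u (s v) = 0 := by
    rw [sub_eq_zero]
    exact (arc_ε _ v hv rfl).trans ((congrArg₂ arc (hs v) rfl).trans (arc_s v hv)).symm
  obtain ⟨p, hp, -⟩ := exists_sub_comp_eq u_eq
  refine ⟨u + p ∘ H.hd, u - ζ + p ∘ H.hd, ⟨fun w hw => ?_, ?_⟩, fun v hv => ?_⟩
  · have hζ : ζ w = 0 := Set.indicator_of_notMem (fun h => hw (Set.image_subset_range _ _ h)) _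
    have := u_sub w
    simp only [Pi.add_apply, Pi.sub_apply, comp_apply, hd_δ, hζ, sub_zero, true_and] at this ⊢
    linear_combination -this
  · rintro _ ⟨v, rfl⟩
    have h1 := u_sub (s v)
    have h2 : p v - p (H.hd (H.ε (s v))) = u (H.ε (s v)) - u (s v) := hp v
    simp only [Pi.add_apply, Pi.sub_apply, comp_apply, hd_δ, hs v]
    exact ⟨by linear_combination h2, by linear_combination h2 - h1⟩
  · have hζ : ζ (s v) = 1 := Set.indicator_of_mem (Set.mem_image_of_mem s hv) _
    simp only [Pi.add_apply, Pi.sub_apply, hζ]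
    ring

section Count

theorem two_mul_finrank_invariantFun_le [Finite W] [Finite X] (hs : LeftInverse H.hd s) :
    2 * Module.finrank K (invariantFun K (H.pred s)) ≤
      Module.finrank K (H.sideFun K (Set.range s)) := by
  obtain ⟨D, E, hDE, hjump⟩ := H.exists_mem_sideFun_sub_eq_one (K := K) hs
  have hone : ((1 : W → K), (1 : W → K)) ∈ H.sideFun K (Set.range s) :=
    ⟨fun _ _ => ⟨rfl, rfl⟩, fun _ _ => ⟨rfl, rfl⟩⟩
  let mulBy (L : (W → K) × (W → K)) : (X → K) →ₗ[K] (W → K) × (W → K) :=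
    (LinearMap.mulRight K L.1 ∘ₗ LinearMap.funLeft K K H.hd).prod
      (LinearMap.mulRight K L.2 ∘ₗ LinearMap.funLeft K K H.hd)
  let I : (invariantFun K (H.pred s) × invariantFun K (H.pred s)) →ₗ[K] (W → K) × (W → K) :=
    (mulBy (D, E)).domRestrict _ |>.coprod ((mulBy 1).domRestrict _)
  have range_le : LinearMap.range I ≤ H.sideFun K (Set.range s) := by
    rintro _ ⟨⟨⟨p, hp⟩, ⟨q, hq⟩⟩, rfl⟩
    exact add_mem (H.mul_mem_sideFun hs hp hDE) (H.mul_mem_sideFun hs hq hone)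
  have I_injective : Injective I := by
    rw [injective_iff_map_eq_zero]
    rintro ⟨⟨p, hp⟩, ⟨q, hq⟩⟩ h0
    obtain ⟨n, hn⟩ := exists_iterate_mem_periodicPts (H.pred s)
    have h1 (v : X) : p v * D (s v) + q v = 0 := by
      simpa [I, mulBy, hs v] using congrFun (congrArg Prod.fst h0) (s v)
    have h2 (v : X) : p v * E (s v) + q v = 0 := by
      simpa [I, mulBy, hs v] using congrFun (congrArg Prod.snd h0) (s v)
    have hp0 (v : X) : p v = 0 := by
      rw [← invariantFun_apply_iterate hp n]
      linear_combination h1 ((H.pred s)^[n] v) - h2 ((H.pred s)^[n] v) -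
        p ((H.pred s)^[n] v) * hjump _ (hn v)
    have hq0 (v : X) : q v = 0 := by rw [← h1 v, hp0, zero_mul, zero_add]
    ext v
    exacts [hp0 v, hq0 v]
  calc 2 * Module.finrank K (invariantFun K (H.pred s))
      = Module.finrank K (LinearMap.range I) := by
        rw [LinearMap.finrank_range_of_inj I_injective, Module.finrank_prod, two_mul]
    _ ≤ Module.finrank K (H.sideFun K (Set.range s)) := Submodule.finrank_mono range_le

variable [Finite U] {H} (hH : H.IsToric)

include hH

theorem finrank_flows_range [Fintype W] (hs : LeftInverse H.hd s) :
    Module.finrank K (H.flows K (Set.range s)) =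
      Module.finrank K (H.cutFun K (Set.range s)) := by
  have h1 := H.finrank_flows_add (K := K) (Set.range s)
  have h2 : (Set.range s).ncard = Nat.card X :=
    (Nat.card_coe_set_eq _).symm.trans (Nat.card_range_of_injective hs.injective)
  rw [IsToric] at hH
  omega

theorem finrank_cutFun_range [Finite W] [Finite X] (hs : LeftInverse H.hd s)
    (hns : H.IsNonseparating s) :
    Module.finrank K (H.cutFun K (Set.range s)) =
      Module.finrank K (invariantFun K (H.pred s)) := by
  have := Fintype.ofFinite W
  have h1 := H.finrank_cutFun_le_finrank_invariantFun (K := K) hs hns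
  have h2 := H.two_mul_finrank_invariantFun_le (K := K) hs
  have h3 := H.finrank_sideFun_le (K := K) (Set.range s)
  have h4 := H.finrank_flows_range (K := K) hH hs
  omega

theorem card_connectedComponent_cut_range [Finite W] [Finite X] (hs : LeftInverse H.hd s)
    (hns : H.IsNonseparating s) :
    Nat.card (H.cut (Set.range s)).ConnectedComponent =
      (forwardOrbit (H.pred s) '' periodicPts (H.pred s)).ncard := by
  rw [← H.finrank_cutFun (K := ℚ), H.finrank_cutFun_range hH hs hns, finrank_invariantFun]

end Count

end BipartiteMap

/-! ### Matchings -/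

namespace BipartiteMap

variable {W X U : Type*} {H : BipartiteMap W X U} {K : Type*} [Field K] {s : X → W}

section Component

variable {C : (H.cut (Set.range s)).ConnectedComponent}

theorem exists_forall_apply_hd_eq [Fintype W] (hs : LeftInverse H.hd s)
    (hflow : ∀ φ ∈ H.flows K (Set.range s), (∀ w, H.a w ∉ C.supp → φ w = 0) → φ = 0) {p : X → K}
    (hp : p ∈ invariantFun K (H.pred s)) :
    ∃ c, ∀ w, (H.a w ∈ C.supp ∨ H.b w ∈ C.supp) → p (H.hd w) = c := by
  have hside := H.mul_mem_sideFun hs hp (H.comp_mem_sideFun (H.indicator_supp_mem_cutFun C))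
  obtain ⟨f, hf, hfa, hfb⟩ := H.exists_eq_comp_of_mem_sideFun hside
    (hflow _ (H.sub_comp_mem_flows hside) fun w hw => by
      simp only [Pi.sub_apply, comp_apply, Pi.mul_apply, a_ε, Set.indicator_of_notMem hw, mul_zero,
        sub_zero])
  have f_eq {x : U} (hx : x ∈ C.supp) : f x = f C.out :=
    H.apply_eq_of_reachable hf (SimpleGraph.ConnectedComponent.eq.1 (hx.trans C.out_eq.symm))
  refine ⟨f C.out, ?_⟩
  rintro w (hw | hw)
  · rw [← f_eq hw, ← comp_apply (f := f), hfa, Pi.mul_apply, comp_apply, comp_apply,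
      Set.indicator_of_mem hw, Pi.one_apply, mul_one]
  · rw [← f_eq hw, ← comp_apply (f := f), hfb, Pi.mul_apply, comp_apply, comp_apply,
      Set.indicator_of_mem hw, Pi.one_apply, mul_one]

theorem grad_indicator_supp_eq_zero [Fintype W] [Finite X] (hs : LeftInverse H.hd s)
    (hns : H.IsNonseparating s)
    (hflow : ∀ φ ∈ H.flows K (Set.range s), (∀ w, H.a w ∉ C.supp → φ w = 0) → φ = 0) :
    H.grad K (C.supp.indicator 1) = 0 := by
  have mem_or_mem {w : W} (hw : H.grad K (C.supp.indicator 1) w ≠ 0) :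
      H.a w ∈ C.supp ∨ H.b w ∈ C.supp := by
    contrapose! hw
    exact H.grad_indicator_one_eq_zero_iff.2 (iff_of_false hw.1 hw.2)
  have hf := H.indicator_supp_mem_cutFun (K := K) C
  refine H.grad_eq_zero_of_forall_periodicPts hs hf fun v hv => ?_
  by_contra hne
  obtain ⟨c, hc⟩ := exists_forall_apply_hd_eq hs hflow (indicator_basin_mem_invariantFun K _ v)
  have hc_one := hc _ (mem_or_mem hne)
  rw [hs, Set.indicator_of_mem (self_mem_basin _ v)] at hc_one
  refine hns.not_isBoundary hv (H.isBoundary_orbitEdges hs hv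
    (H.mem_cutFun_orbitEdges hs hf fun u hu hnot => ?_) hne)
  by_contra hne'
  have hc_zero := hc _ (mem_or_mem hne')
  rw [hs, Set.indicator_of_notMem fun h => hnot (mem_forwardOrbit_of_mem_basin hu h),
    ← hc_one] at hc_zero
  exact zero_ne_one hc_zero

variable (K C)

theorem exists_flow_ne_zero [Fintype W] [Finite X] [Finite U] (hH : H.IsToric)
    (hs : LeftInverse H.hd s) (hns : H.IsNonseparating s) :
    ∃ φ ∈ H.flows K (Set.range s), (∀ w, H.a w ∉ C.supp → φ w = 0) ∧ φ ≠ 0 := by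
  by_contra! hflow
  obtain ⟨x, hx⟩ := C.nonempty_supp
  have mem_supp (y : U) : y ∈ C.supp := by
    by_contra hy
    have := H.apply_eq_of_grad_eq_zero (grad_indicator_supp_eq_zero hs hns hflow) x y
    rw [Set.indicator_of_mem hx, Set.indicator_of_notMem hy] at this
    exact one_ne_zero this
  have flows_eq_bot : H.flows K (Set.range s) = ⊥ := (Submodule.eq_bot_iff _).2 fun φ hφ =>
    hflow φ hφ fun w hw => absurd (mem_supp _) hw
  have cutFun_eq_bot : H.cutFun K (Set.range s) = ⊥ := by
    rw [← Submodule.finrank_eq_zero, ← finrank_flows_range hH hs, flows_eq_bot, finrank_bot]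
  have hmem := H.indicator_supp_mem_cutFun (K := K) C
  rw [cutFun_eq_bot, Submodule.mem_bot] at hmem
  have := congrFun hmem x
  rw [Set.indicator_of_mem hx] at this
  exact one_ne_zero this

variable {C}

/-- In every component, an edge of its unique cycle can be chosen. -/
theorem exists_transversal [Fintype W] [Finite X] [Finite U] (hH : H.IsToric)
    (hs : LeftInverse H.hd s) (hns : H.IsNonseparating s) :
    ∃ e : (H.cut (Set.range s)).ConnectedComponent → W,
      (∀ C, H.a (e C) ∈ C.supp) ∧ (∀ C, e C ∉ Set.range s) ∧
        H.flows K (Set.range s ∪ Set.range e) = ⊥ := by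
  classical
  have := Fintype.ofFinite (H.cut (Set.range s)).ConnectedComponent
  choose φ hφ hsupp hne using fun C => exists_flow_ne_zero K C hH hs hns
  choose e he using fun C => ne_iff.1 (hne C)
  have hmem (C) : H.a (e C) ∈ C.supp := by
    by_contra h
    exact he C (hsupp C _ h)
  have φ_eq_zero {C C'} (h : C ≠ C') : φ C (e C') = 0 :=
    hsupp C _ fun h' => h (h'.symm.trans (hmem C'))
  refine ⟨e, hmem, fun C h => he C ((hφ C).1 _ h), ?_⟩
  let ev : H.flows K (Set.range s) →ₗ[K] ((H.cut (Set.range s)).ConnectedComponent → K) :=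
    (LinearMap.funLeft K K e).domRestrict _
  have ev_surjective : Surjective ev := by
    intro y
    refine ⟨∑ C, (y C / φ C (e C)) • ⟨φ C, hφ C⟩, funext fun C' => ?_⟩
    rw [map_sum, Finset.sum_apply, Finset.sum_eq_single C']
    · exact div_mul_cancel₀ _ (he C')
    · exact fun C _ h => (congrArg _ (φ_eq_zero h)).trans (mul_zero _)
    · simp
  have hrank : Module.finrank K (H.flows K (Set.range s)) =
      Module.finrank K ((H.cut (Set.range s)).ConnectedComponent → K) := by
    rw [finrank_flows_range hH hs, H.finrank_cutFun, Module.finrank_fintype_fun_eq_card,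
      Nat.card_eq_fintype_card]
  have ev_injective : Injective ev :=
    (LinearMap.injective_iff_surjective_of_finrank_eq_finrank hrank).2 ev_surjective
  refine (Submodule.eq_bot_iff _).2 fun ψ hψ => ?_
  have hψ' : ψ ∈ H.flows K (Set.range s) := ⟨fun w hw => hψ.1 w (Or.inl hw), hψ.2⟩
  exact congrArg Subtype.val <| (injective_iff_map_eq_zero ev).1 ev_injective ⟨ψ, hψ'⟩ <|
    funext fun C => hψ.1 _ (Or.inr ⟨C, rfl⟩)

theorem cutFun_union_range_le [Fintype W] [Finite X] [Finite U] (hH : H.IsToric)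
    (hs : LeftInverse H.hd s) {e : (H.cut (Set.range s)).ConnectedComponent → W}
    (he : ∀ C, H.a (e C) ∈ C.supp) (hes : ∀ C, e C ∉ Set.range s)
    (hflows : H.flows K (Set.range s ∪ Set.range e) = ⊥) :
    H.cutFun K (Set.range s ∪ Set.range e) ≤ H.cutFun K (Set.range s) := by
  have e_injective : Injective e := fun C C' h => by
    rw [← he C, h, he C']
  have ncard_union : (Set.range s ∪ Set.range e).ncard =
      Nat.card X + Nat.card (H.cut (Set.range s)).ConnectedComponent := by
    rw [Set.ncard_union_eq (Set.disjoint_right.2 ?_), ← Nat.card_coe_set_eq,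
      ← Nat.card_coe_set_eq, Nat.card_range_of_injective hs.injective,
      Nat.card_range_of_injective e_injective]
    rintro _ ⟨C, rfl⟩
    exact hes C
  have hle := H.cutFun_mono (K := K) (Set.subset_union_left (s := Set.range s) (t := Set.range e))
  have h := H.finrank_flows_add (K := K) (Set.range s ∪ Set.range e)
  rw [hflows, finrank_bot, ncard_union, ← H.finrank_cutFun (K := K)] at h
  rw [IsToric] at hH
  exact (Submodule.eq_of_le_of_finrank_eq hle (by omega)).ge

end Component

section Matching

variable {m m' : W ≃ X ⊕ U}

/-- The bijection `m` matches every edge to its head or to one of its ends, and the edges chosen by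
`s` to their heads. -/
def IsMatching (H : BipartiteMap W X U) (s : X → W) (m : W ≃ X ⊕ U) : Prop :=
  (∀ w, m w = Sum.inl (H.hd w) ∨ m w = Sum.inr (H.a w) ∨ m w = Sum.inr (H.b w)) ∧
    ∀ v, m (s v) = Sum.inl v

theorem IsMatching.eq_or_eq (hm : H.IsMatching s m) {w : W} (hw : w ∉ Set.range s) :
    m w = Sum.inr (H.a w) ∨ m w = Sum.inr (H.b w) :=
  (hm.1 w).resolve_left fun h => hw ⟨H.hd w, m.injective ((hm.2 _).trans h.symm)⟩

theorem IsMatching.dotProduct_grad [Fintype W] [Finite X] [Fintype U] (hm : H.IsMatching s m)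
    (f : U → K) :
    {w | m w = Sum.inr (H.a w)}.indicator 1 ⬝ᵥ H.grad K f =
      ∑ x, f x - ∑ w, (Set.range s)ᶜ.indicator (f ∘ H.b) w := by
  classical
  have := Fintype.ofFinite X
  have sum_eq : ∑ w, (Sum.elim 0 f : X ⊕ U → K) (m w) = ∑ x, f x := by
    rw [Equiv.sum_comp m (Sum.elim 0 f), Fintype.sum_sum_type]
    simp
  rw [← sum_eq, ← Finset.sum_sub_distrib]
  refine Finset.sum_congr rfl fun w _ => ?_
  rw [grad_apply]
  by_cases hw : w ∈ Set.range s
  · obtain ⟨v, rfl⟩ := hw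
    simp [hm.2]
  · rcases hm.eq_or_eq hw with h | h
    · simp [h, hw]
    · simp [h, hw, (H.a_ne_b w w).symm]

theorem IsMatching.sub_mem_flows [Fintype W] [Finite X] [Finite U] (hm : H.IsMatching s m)
    (hm' : H.IsMatching s m') :
    {w | m w = Sum.inr (H.a w)}.indicator 1 - {w | m' w = Sum.inr (H.a w)}.indicator 1 ∈
      H.flows K (Set.range s) := by
  have := Fintype.ofFinite U
  refine ⟨?_, fun f => by rw [sub_dotProduct, hm.dotProduct_grad, hm'.dotProduct_grad, sub_self]⟩
  rintro _ ⟨v, rfl⟩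
  simp [hm.2, hm'.2]

variable (K) in
theorem IsMatching.eq_of_forall_mem [Fintype W] [Finite X] [Finite U] {T : Set W}
    (hT : H.flows K (Set.range s ∪ T) = ⊥) (hm : H.IsMatching s m) (hm' : H.IsMatching s m')
    (h : ∀ w ∈ T, m w = Sum.inr (H.a w) ↔ m' w = Sum.inr (H.a w)) : m = m' := by
  classical
  have hflow := hm.sub_mem_flows (K := K) hm'
  have sub_eq_zero := (Submodule.eq_bot_iff _).1 hT _ ⟨?_, hflow.2⟩
  · refine Equiv.ext fun w => ?_
    by_cases hw : w ∈ Set.range s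
    · obtain ⟨v, rfl⟩ := hw
      rw [hm.2, hm'.2]
    · have := congrFun sub_eq_zero w
      rcases hm.eq_or_eq hw with h1 | h1 <;> rcases hm'.eq_or_eq hw with h2 | h2 <;>
        simp_all [(H.a_ne_b w w).symm]
  · rintro w (hw | hw)
    · exact hflow.1 w hw
    · simp [Set.indicator_apply, h w hw]

section MatchingRow

variable {T : Set W} {τ : W → U} {w : W}

variable (K) in
open Classical in
/-- The row of an edge in the system of relations "the value is `0` on the faces, which are the
heads of the edges chosen by `s`, and at the end `τ w` of every edge `w` in `T`, and it is constant
along the other edges". It is supported on the possible matches of the edge. -/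
noncomputable def matchingRow (H : BipartiteMap W X U) (s : X → W) (T : Set W) (τ : W → U) (w : W) :
    X ⊕ U → K :=
  if w ∈ Set.range s then Pi.single (Sum.inl (H.hd w)) 1
  else if w ∈ T then Pi.single (Sum.inr (τ w)) 1
  else Pi.single (Sum.inr (H.a w)) 1 - Pi.single (Sum.inr (H.b w)) 1

open Classical in
theorem matchingRow_section (hs : LeftInverse H.hd s) (v : X) :
    H.matchingRow K s T τ (s v) = Pi.single (Sum.inl v) 1 := by
  rw [matchingRow, if_pos (Set.mem_range_self v), hs v]

open Classical in
theorem matchingRow_of_mem (hw : w ∉ Set.range s) (hwT : w ∈ T) :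
    H.matchingRow K s T τ w = Pi.single (Sum.inr (τ w)) 1 := by
  rw [matchingRow, if_neg hw, if_pos hwT]

open Classical in
theorem matchingRow_of_notMem (hw : w ∉ Set.range s) (hwT : w ∉ T) :
    H.matchingRow K s T τ w = Pi.single (Sum.inr (H.a w)) 1 - Pi.single (Sum.inr (H.b w)) 1 := by
  rw [matchingRow, if_neg hw, if_neg hwT]

theorem eq_zero_of_matchingRow_dotProduct_eq_zero [Fintype X] [Fintype U]
    (hs : LeftInverse H.hd s) (hTs : ∀ w ∈ T, w ∉ Set.range s)
    (hcut : H.cutFun K (Set.range s ∪ T) ≤ H.cutFun K (Set.range s))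
    (hT : ∀ x, ∃ w ∈ T, (H.cut (Set.range s)).Reachable (H.a w) x)
    (hτ : ∀ w, τ w = H.a w ∨ τ w = H.b w) {y : X ⊕ U → K}
    (hy : ∀ w, H.matchingRow K s T τ w ⬝ᵥ y = 0) : y = 0 := by
  classical
  have hf : y ∘ Sum.inr ∈ H.cutFun K (Set.range s) := hcut fun w hw => by
    rw [Set.mem_union, not_or] at hw
    have := hy w
    rwa [matchingRow_of_notMem hw.1 hw.2, sub_dotProduct, single_one_dotProduct,
      single_one_dotProduct] at this
  ext (v | x)
  · have := hy (s v)
    rwa [matchingRow_section hs, single_one_dotProduct] at this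
  · obtain ⟨w, hw, hwx⟩ := hT x
    have hab := H.apply_a_eq_apply_b hf (hTs w hw)
    have hτ_zero := hy w
    rw [matchingRow_of_mem (hTs w hw) hw, single_one_dotProduct] at hτ_zero
    refine (H.apply_eq_of_reachable hf hwx).symm.trans ?_
    rcases hτ w with h | h
    exacts [(congrArg _ h.symm).trans hτ_zero, hab.trans ((congrArg _ h.symm).trans hτ_zero)]

variable (K)

theorem exists_isMatching_forall_mem [Finite W] [Finite X] [Finite U] (hH : H.IsToric)
    (hs : LeftInverse H.hd s) (hTs : ∀ w ∈ T, w ∉ Set.range s)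
    (hcut : H.cutFun K (Set.range s ∪ T) ≤ H.cutFun K (Set.range s))
    (hT : ∀ x, ∃ w ∈ T, (H.cut (Set.range s)).Reachable (H.a w) x)
    (hτ : ∀ w, τ w = H.a w ∨ τ w = H.b w) :
    ∃ m, H.IsMatching s m ∧ ∀ w ∈ T, m w = Sum.inr (τ w) := by
  classical
  have := Fintype.ofFinite W
  have := Fintype.ofFinite X
  have := Fintype.ofFinite U
  have hcard : Fintype.card W = Fintype.card (X ⊕ U) := by
    simpa only [IsToric, Nat.card_eq_fintype_card, Fintype.card_sum] using hH
  -- a nonzero term of the determinant of the system is a matching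
  obtain ⟨m, hm⟩ := exists_equiv_forall_ne_zero hcard fun y =>
    eq_zero_of_matchingRow_dotProduct_eq_zero (K := K) (y := y) hs hTs hcut hT hτ
  have eq_of_row_eq {w : W} {i : X ⊕ U} (h : H.matchingRow K s T τ w = Pi.single i 1) :
      m w = i := by
    by_contra hne
    exact hm w (by rw [h, Pi.single_eq_of_ne hne])
  have eq_of_mem_T {w : W} (hw : w ∈ T) : m w = Sum.inr (τ w) :=
    eq_of_row_eq (matchingRow_of_mem (hTs w hw) hw)
  refine ⟨m, ⟨fun w => ?_, fun v => eq_of_row_eq (matchingRow_section hs v)⟩,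
    fun w => eq_of_mem_T⟩
  by_cases hw : w ∈ Set.range s
  · obtain ⟨v, rfl⟩ := hw
    exact Or.inl ((eq_of_row_eq (matchingRow_section hs v)).trans (congrArg _ (hs v).symm))
  · refine Or.inr ?_
    by_cases hwT : w ∈ T
    · rw [eq_of_mem_T hwT]
      exact (hτ w).imp (congrArg _) (congrArg _)
    · by_contra! hne
      refine hm w ?_
      rw [matchingRow_of_notMem hw hwT, Pi.sub_apply, Pi.single_eq_of_ne hne.1,
        Pi.single_eq_of_ne hne.2, sub_self]

end MatchingRow

theorem card_isMatching [Finite W] [Finite X] [Finite U] (hH : H.IsToric)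
    (hs : LeftInverse H.hd s) (hns : H.IsNonseparating s) :
    Nat.card {m // H.IsMatching s m} =
      2 ^ (forwardOrbit (H.pred s) '' periodicPts (H.pred s)).ncard := by
  classical
  have := Fintype.ofFinite W
  obtain ⟨e, he, hes, hflows⟩ := exists_transversal ℚ hH hs hns
  let choice (m : {m // H.IsMatching s m}) : Set (H.cut (Set.range s)).ConnectedComponent :=
    {C | m.1 (e C) = Sum.inr (H.a (e C))}
  have choice_injective : Injective choice := fun m m' h => Subtype.ext <|
    m.2.eq_of_forall_mem ℚ hflows m'.2 <| Set.forall_mem_range.2 fun C => Set.ext_iff.1 h C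
  have choice_surjective : Surjective choice := fun t => by
    let τ (w : W) : U :=
      if (H.cut (Set.range s)).connectedComponentMk (H.a w) ∈ t then H.a w else H.b w
    obtain ⟨m, hm, hmτ⟩ := exists_isMatching_forall_mem ℚ hH hs (Set.forall_mem_range.2 hes)
      (cutFun_union_range_le ℚ hH hs he hes hflows)
      (fun x => ⟨_, ⟨(H.cut (Set.range s)).connectedComponentMk x, rfl⟩,
        SimpleGraph.ConnectedComponent.eq.1 (he _)⟩)
      (τ := τ) (fun w => ite_eq_or_eq _ _ _)
    refine ⟨⟨m, hm⟩, Set.ext fun C => ?_⟩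
    have hτ : τ (e C) = if C ∈ t then H.a (e C) else H.b (e C) := by
      simp only [τ, (SimpleGraph.ConnectedComponent.mem_supp_iff _ _).1 (he C)]
    rw [Set.mem_ofPred_eq, hmτ _ ⟨C, rfl⟩, hτ, Sum.inr.injEq]
    by_cases hC : C ∈ t <;> simp [hC, (H.a_ne_b _ _).symm]
  rw [Nat.card_eq_of_bijective choice ⟨choice_injective, choice_surjective⟩,
    ← card_connectedComponent_cut_range hH hs hns]
  have := Fintype.ofFinite (H.cut (Set.range s)).ConnectedComponent
  simp only [Nat.card_eq_fintype_card, Fintype.card_set]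

end Matching

end BipartiteMap

/-! ### The bipartite maps of a trinity -/

/-- The cyclic order of the three colours around a white triangle, up to orientation. -/
def TrinityColor.next : TrinityColor → TrinityColor
  | red => green
  | green => blue
  | blue => red

theorem TrinityColor.next_ne : ∀ c : TrinityColor, c.next ≠ c := by decide

theorem TrinityColor.next_next_ne : ∀ c : TrinityColor, c.next.next ≠ c := by decide

theorem TrinityColor.eq_or_eq_next_or_eq_next_next :
    ∀ c x : TrinityColor, x = c ∨ x = c.next ∨ x = c.next.next := by decide

theorem TrinityColor.eq_or_eq_of_ne :
    ∀ x y z u : TrinityColor, x ≠ y → x ≠ z → y ≠ z → u ≠ z → u = x ∨ u = y := by decide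

namespace Trinity

variable {W B : Type*} (T : Trinity W B) {c : TrinityColor}

instance [Finite W] [Finite B] : Finite T.Vertex :=
  inferInstanceAs (Finite (Quot T.GluedCorners))

theorem blackVertex_glue {x y : TrinityColor} (h : x ≠ y) (w : W) :
    T.blackVertex (T.glue x w) y = T.whiteVertex w y :=
  (Quot.sound ⟨w, x, y, h, rfl, rfl⟩).symm

theorem color_whiteVertex (w : W) (c : TrinityColor) : T.color (T.whiteVertex w c) = c := rfl

theorem exists_whiteVertex_eq (v : T.Vertex) : ∃ w, T.whiteVertex w (T.color v) = v := by
  induction v using Quot.ind with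
  | mk p =>
    obtain ⟨w | b, y⟩ := p
    · exact ⟨w, rfl⟩
    · refine ⟨(T.glue y.next).symm b, (T.blackVertex_glue y.next_ne _).symm.trans ?_⟩
      rw [Equiv.apply_symm_apply]
      rfl

theorem whiteVertex_eq_whiteVertex_iff {x y z : TrinityColor} (hxy : x ≠ y) (hxz : x ≠ z)
    (hyz : y ≠ z) (w w' : W) :
    T.whiteVertex w z = T.whiteVertex w' z ↔
      Equiv.Perm.SameCycle ((T.glue x).trans (T.glue y).symm) w w' := by
  set ρ : Equiv.Perm W := (T.glue x).trans (T.glue y).symm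
  refine ⟨fun h => ?_, apply_eq_of_sameCycle (F := fun w => T.whiteVertex w z) fun w => ?_⟩
  · let P : T.Vertex → Prop := Quot.lift
      (fun p => p.2 = z ∧ Sum.elim (ρ.SameCycle w) (fun b => ρ.SameCycle w ((T.glue x).symm b)) p.1)
      (by
        rintro _ _ ⟨w'', u, v, huv, rfl, rfl⟩
        refine propext (and_congr_right ?_)
        rintro rfl
        rcases TrinityColor.eq_or_eq_of_ne x y _ u hxy hxz hyz huv with rfl | rfl
        · simp
        · exact Equiv.Perm.sameCycle_symm_apply_right.symm)
    have hP : P (T.whiteVertex w z) = P (T.whiteVertex w' z) := congrArg P h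
    exact (hP.mp ⟨rfl, Equiv.Perm.SameCycle.refl ρ w⟩).2
  · rw [← T.blackVertex_glue hyz, ← T.blackVertex_glue hxz]
    simp [ρ]

theorem apply_eq_of_connected (hT : (SimpleGraph.fromRel T.GluedTriangles).Connected) {α : Type*}
    {F : W ⊕ B → α} (hF : ∀ x w, F (Sum.inr (T.glue x w)) = F (Sum.inl w)) (s t : W ⊕ B) :
    F s = F t := by
  obtain ⟨p⟩ := hT.preconnected s t
  induction p with
  | nil => rfl
  | cons hadj _ ih =>
    rw [← ih]
    obtain ⟨-, ⟨w, x, rfl, rfl⟩ | ⟨w, x, rfl, rfl⟩⟩ := (SimpleGraph.fromRel_adj _ _ _).1 hadj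
    exacts [(hF x w).symm, hF x w]

theorem isPretransitive_closure (hT : (SimpleGraph.fromRel T.GluedTriangles).Connected)
    (c : TrinityColor) :
    MulAction.IsPretransitive (Subgroup.closure
      {(T.glue c).trans (T.glue c.next).symm, (T.glue c).trans (T.glue c.next.next).symm}) W := by
  set N : Subgroup (Equiv.Perm W) := Subgroup.closure
    {(T.glue c).trans (T.glue c.next).symm, (T.glue c).trans (T.glue c.next.next).symm}
  refine ⟨fun w w' => ?_⟩
  let orbit (w : W) : MulAction.orbitRel.Quotient N W := Quotient.mk'' w
  have orbit_apply {g : Equiv.Perm W} (hg : g ∈ N) (w : W) : orbit (g w) = orbit w :=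
    Quotient.sound' ⟨⟨g, hg⟩, rfl⟩
  have glue_symm_glue (x : TrinityColor) (w : W) :
      orbit ((T.glue c).symm (T.glue x w)) = orbit w := by
    rcases c.eq_or_eq_next_or_eq_next_next x with rfl | rfl | rfl
    · rw [Equiv.symm_apply_apply]
    · exact orbit_apply (inv_mem (Subgroup.subset_closure (Or.inl rfl))) w
    · exact orbit_apply (inv_mem (Subgroup.subset_closure (Or.inr rfl))) w
  have orbit_eq : orbit w' = orbit w :=
    T.apply_eq_of_connected hT (F := Sum.elim orbit fun b => orbit ((T.glue c).symm b))
      glue_symm_glue (Sum.inl w') (Sum.inl w)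
  exact Quotient.exact' orbit_eq

/-- The graph `G_c` of the edges of colour `c`, with the vertices of colour `c` as its faces. -/
def toBipartiteMap (hT : (SimpleGraph.fromRel T.GluedTriangles).Connected) (c : TrinityColor) :
    BipartiteMap W {x : T.Vertex // T.color x = c} {x : T.Vertex // T.color x ≠ c} where
  δ := (T.glue c).trans (T.glue c.next).symm
  ε := (T.glue c).trans (T.glue c.next.next).symm
  hd w := ⟨T.whiteVertex w c, T.color_whiteVertex w c⟩
  a w := ⟨T.whiteVertex w c.next, (T.color_whiteVertex w _).trans_ne c.next_ne⟩
  b w := ⟨T.whiteVertex w c.next.next, (T.color_whiteVertex w _).trans_ne c.next_next_ne⟩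
  hd_surjective := by
    rintro ⟨v, rfl⟩
    obtain ⟨w, hw⟩ := T.exists_whiteVertex_eq v
    exact ⟨w, Subtype.ext hw⟩
  hd_eq_iff w w' := by
    have mul_inv_eq : ((T.glue c).trans (T.glue c.next).symm : Equiv.Perm W) *
        ((T.glue c).trans (T.glue c.next.next).symm)⁻¹ =
          (T.glue c.next.next).trans (T.glue c.next).symm :=
      Equiv.ext fun w => congrArg (T.glue c.next).symm ((T.glue c).apply_symm_apply _)
    rw [mul_inv_eq, Subtype.ext_iff]
    exact T.whiteVertex_eq_whiteVertex_iff c.next.next_ne c.next_next_ne c.next_ne w w'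
  a_eq_iff w w' := Subtype.ext_iff.trans
    (T.whiteVertex_eq_whiteVertex_iff c.next_next_ne.symm c.next_ne.symm c.next.next_ne w w')
  b_eq_iff w w' := Subtype.ext_iff.trans
    (T.whiteVertex_eq_whiteVertex_iff c.next_ne.symm c.next_next_ne.symm c.next.next_ne.symm w w')
  a_ne_b w w' h := c.next.next_ne (congrArg T.color (Subtype.ext_iff.1 h)).symm
  exists_end := by
    rintro ⟨v, hv⟩
    obtain ⟨w, hw⟩ := T.exists_whiteVertex_eq v
    refine ⟨w, ?_⟩
    rcases c.eq_or_eq_next_or_eq_next_next (T.color v) with h | h | h <;> rw [h] at hw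
    exacts [absurd h hv, Or.inl (Subtype.ext hw), Or.inr (Subtype.ext hw)]
  isPretransitive := T.isPretransitive_closure hT c
  nonempty := by
    obtain ⟨w | b⟩ := hT.nonempty
    exacts [⟨w⟩, ⟨(T.glue c).symm b⟩]

/-- The vertices, sorted by whether they have the colour `c`. -/
def sumColorEquiv (c : TrinityColor) :
    {x : T.Vertex // T.color x = c} ⊕ {x : T.Vertex // T.color x ≠ c} ≃ T.Vertex :=
  Equiv.sumCompl fun x => T.color x = c

theorem isToric_toBipartiteMap [Finite W] [Finite B] (hT : T.IsToric) (c : TrinityColor) :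
    (T.toBipartiteMap hT.1 c).IsToric := by
  have card_color : Nat.card TrinityColor = 3 := Nat.card_eq_fintype_card
  have card_vertex := Nat.card_congr (T.sumColorEquiv c)
  have card_black := Nat.card_congr (T.glue c)
  have euler := hT.2
  rw [eulerChar, Nat.card_prod, Nat.card_sum, card_color, ← card_black, ← card_vertex,
    Nat.card_sum] at euler
  rw [BipartiteMap.IsToric]
  push_cast at euler
  omega

variable {T}
variable {hT : (SimpleGraph.fromRel T.GluedTriangles).Connected}
  {s : {x : T.Vertex // T.color x = c} → W}

theorem tail_eq (w : W) : T.tail c w = ((T.toBipartiteMap hT c).tl w).1 := by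
  change T.blackVertex (T.glue c w) c =
    T.whiteVertex ((T.glue c.next.next).symm (T.glue c w)) c
  rw [← T.blackVertex_glue c.next_next_ne, Equiv.apply_symm_apply]

theorem exists_eq_whiteVertex_iff (x : {x : T.Vertex // T.color x ≠ c}) (w : W) :
    (∃ y, x.1 = T.whiteVertex w y) ↔
      x = (T.toBipartiteMap hT c).a w ∨ x = (T.toBipartiteMap hT c).b w := by
  refine ⟨fun ⟨y, hy⟩ => ?_, ?_⟩
  · rcases c.eq_or_eq_next_or_eq_next_next y with rfl | rfl | rfl
    exacts [absurd (congrArg T.color hy) x.2, Or.inl (Subtype.ext hy), Or.inr (Subtype.ext hy)]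
  · rintro (rfl | rfl)
    exacts [⟨_, rfl⟩, ⟨_, rfl⟩]

theorem complementGraph_eq_cut (C : Set W) :
    T.complementGraph c C = (T.toBipartiteMap hT c).cut C := by
  ext x y
  simp only [complementGraph, BipartiteMap.cut, exists_eq_whiteVertex_iff (hT := hT)]

theorem head_section (hs : LeftInverse (T.toBipartiteMap hT c).hd s) (v) :
    T.head c (s v) = v.1 :=
  congrArg Subtype.val (hs v)

theorem IsCycle.exists_eq_orbitEdges (hs : LeftInverse (T.toBipartiteMap hT c).hd s) {C : Set W}
    (hC : T.IsCycle c C) (hCs : C ⊆ Set.range s) :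
    ∃ v ∈ periodicPts ((T.toBipartiteMap hT c).pred s),
      (T.toBipartiteMap hT c).orbitEdges s v = C := by
  obtain ⟨m, v, e, hm, -, he, rfl, hedge⟩ := hC
  have : NeZero m := ⟨hm.ne'⟩
  choose x hx using fun i => hCs ⟨i, rfl⟩
  obtain rfl : s ∘ x = e := funext hx
  have hpair (i : ZMod m) :
      s(((T.toBipartiteMap hT c).pred s (x i)).1, (x i).1) = s(v i, v (i + 1)) := by
    rw [← hedge i, comp_apply, head_section hs, tail_eq (hT := hT)]
    rfl
  have hσ (i : ZMod m) : ∃ j, (x i).1 = v j ∧ (j = i ∨ j = i + 1) := by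
    rcases Sym2.mem_iff.1 (hpair i ▸ Sym2.mem_mk_right _ _) with h | h
    exacts [⟨i, h, Or.inl rfl⟩, ⟨i + 1, h, Or.inr rfl⟩]
  choose σ hσ_eq hσ_or using hσ
  have σ_injective : Injective σ := fun i j h =>
    he (congrArg s (Subtype.ext (by rw [hσ_eq, hσ_eq, h])))
  -- the cycle is traversed against the direction of its edges or along it
  rcases eq_id_or_eq_add_one_of_injective σ_injective hσ_or with hσ | hσ
  · have hstep (i : ZMod m) : (T.toBipartiteMap hT c).pred s (x i) = x (i + 1) :=
      Subtype.ext (by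
        have := hpair i
        rw [hσ_eq i, hσ i, Sym2.eq_swap, Sym2.congr_right] at this
        rw [this, hσ_eq, hσ])
    obtain ⟨hper, hrange⟩ := mem_periodicPts_and_range_eq_forwardOrbit hm hstep
    exact ⟨_, hper, by rw [BipartiteMap.orbitEdges, ← hrange, Set.range_comp]⟩
  · have hstep (i : ZMod m) : (T.toBipartiteMap hT c).pred s (x (-i)) = x (-(i + 1)) :=
      Subtype.ext (by
        have := hpair (-i)
        rw [hσ_eq (-i), hσ, Sym2.congr_left] at this
        rw [this, hσ_eq, hσ, neg_add, neg_add_cancel_right])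
    obtain ⟨hper, hrange⟩ := mem_periodicPts_and_range_eq_forwardOrbit (x := fun i => x (-i)) hm
      hstep
    have range_neg : Set.range (fun i => x (-i)) = Set.range x :=
      (Equiv.neg (ZMod m)).surjective.range_comp x
    exact ⟨_, hper, by rw [BipartiteMap.orbitEdges, ← hrange, range_neg, Set.range_comp]⟩

theorem isCycle_orbitEdges (hs : LeftInverse (T.toBipartiteMap hT c).hd s)
    {v : {x : T.Vertex // T.color x = c}} (hv : v ∈ periodicPts ((T.toBipartiteMap hT c).pred s)) :
    T.IsCycle c ((T.toBipartiteMap hT c).orbitEdges s v) := by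
  set f := (T.toBipartiteMap hT c).pred s
  have hm := minimalPeriod_pos_of_mem_periodicPts hv
  have : NeZero (minimalPeriod f v) := ⟨hm.ne'⟩
  let x (i : ZMod (minimalPeriod f v)) : {x : T.Vertex // T.color x = c} := f^[i.val] v
  have x_injective : Injective x := fun i j h => ZMod.val_injective _ <|
    iterate_injOn_Iio_minimalPeriod (ZMod.val_lt i) (ZMod.val_lt j) h
  have x_natCast (n : ℕ) : x n = f^[n] v := by
    simp only [x, ZMod.val_natCast, iterate_mod_minimalPeriod_eq]
  have x_add_one (i : ZMod (minimalPeriod f v)) : x (i + 1) = f (x i) := by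
    rw [← ZMod.natCast_zmod_val i, ← Nat.cast_succ, x_natCast, x_natCast, iterate_succ_apply']
  refine ⟨_, fun i => (x i).1, s ∘ x, hm, Subtype.val_injective.comp x_injective,
    hs.injective.comp x_injective, ?_, fun i => ?_⟩
  · rw [Set.range_comp, BipartiteMap.orbitEdges, forwardOrbit]
    refine congrArg _ (Set.Subset.antisymm ?_ ?_)
    · rintro _ ⟨i, rfl⟩
      exact ⟨i.val, rfl⟩
    · rintro _ ⟨n, rfl⟩
      exact ⟨n, x_natCast n⟩
  · rw [comp_apply, head_section hs, tail_eq (hT := hT), Sym2.eq_swap]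
    exact congrArg (fun y => s((x i).1, y.1)) (x_add_one i).symm

theorem setOf_isCycle_eq (hs : LeftInverse (T.toBipartiteMap hT c).hd s) :
    {C | C ⊆ Set.range s ∧ T.IsCycle c C} =
      (T.toBipartiteMap hT c).orbitEdges s '' periodicPts ((T.toBipartiteMap hT c).pred s) := by
  ext C
  constructor
  · exact fun ⟨hCs, hC⟩ => hC.exists_eq_orbitEdges hs hCs
  · rintro ⟨v, hv, rfl⟩
    exact ⟨(T.toBipartiteMap hT c).orbitEdges_subset_range v, isCycle_orbitEdges hs hv⟩

theorem numCycles_range (hs : LeftInverse (T.toBipartiteMap hT c).hd s) :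
    T.numCycles c (Set.range s) =
      (forwardOrbit ((T.toBipartiteMap hT c).pred s) ''
        periodicPts ((T.toBipartiteMap hT c).pred s)).ncard := by
  rw [numCycles, setOf_isCycle_eq hs, ← Set.ncard_image_of_injective _ hs.injective.image_injective,
    Set.image_image]
  rfl

theorem isWreath_range_iff (hs : LeftInverse (T.toBipartiteMap hT c).hd s) :
    T.IsWreath c (Set.range s) ↔ (T.toBipartiteMap hT c).IsNonseparating s := by
  have existsUnique (x : T.Vertex) (hx : T.color x = c) :
      ∃! w, w ∈ Set.range s ∧ T.head c w = x := by
    refine ⟨s ⟨x, hx⟩, ⟨⟨_, rfl⟩, head_section hs _⟩, ?_⟩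
    rintro _ ⟨⟨v, rfl⟩, h⟩
    exact congrArg s (Subtype.ext ((head_section hs v).symm.trans h))
  simp only [IsWreath, IsSeparating, not_not, ← and_imp, complementGraph_eq_cut (hT := hT)]
  rw [and_iff_right existsUnique]
  change (∀ C ∈ {C | C ⊆ Set.range s ∧ T.IsCycle c C}, _) ↔ _
  rw [setOf_isCycle_eq hs, Set.forall_mem_image]
  rfl

theorem IsWreath.exists_section {S : Set W} (hS : T.IsWreath c S) :
    ∃ s, LeftInverse (T.toBipartiteMap hT c).hd s ∧ Set.range s = S := by
  choose s hs huniq using fun v : {x : T.Vertex // T.color x = c} => hS.1 v.1 v.2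
  refine ⟨s, fun v => Subtype.ext (hs v).2, Set.Subset.antisymm ?_ fun w hw => ?_⟩
  · exact Set.range_subset_iff.2 fun v => (hs v).1
  · exact ⟨⟨T.head c w, rfl⟩, (huniq _ w ⟨hw, rfl⟩).symm⟩

theorem isMatching_sumColorEquiv_iff (hs : LeftInverse (T.toBipartiteMap hT c).hd s)
    (m : W ≃ T.Vertex) :
    (T.toBipartiteMap hT c).IsMatching s (m.trans (T.sumColorEquiv c).symm) ↔
      (∀ w, ∃ y, m w = T.whiteVertex w y) ∧ ∀ w ∈ Set.range s, m w = T.head c w := by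
  simp only [BipartiteMap.IsMatching, Equiv.trans_apply, Equiv.symm_apply_eq, Set.forall_mem_range,
    head_section hs]
  refine and_congr_left' (forall_congr' fun w => ⟨?_, fun ⟨y, hy⟩ => ?_⟩)
  · rintro (h | h | h)
    exacts [⟨_, h⟩, ⟨_, h⟩, ⟨_, h⟩]
  · rcases c.eq_or_eq_next_or_eq_next_next y with rfl | rfl | rfl
    exacts [Or.inl hy, Or.inr (Or.inl hy), Or.inr (Or.inr hy)]

theorem card_extends_range (hs : LeftInverse (T.toBipartiteMap hT c).hd s) :
    Nat.card {m : T.TutteMatching // T.Extends c m (Set.range s)} =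
      Nat.card {m // (T.toBipartiteMap hT c).IsMatching s m} :=
  Nat.card_congr <| (Equiv.subtypeSubtypeEquivSubtypeInter _ fun m : W ≃ T.Vertex =>
    ∀ w ∈ Set.range s, m w = T.head c w).trans <|
      (Equiv.equivCongr (Equiv.refl W) (T.sumColorEquiv c).symm).subtypeEquiv fun m =>
        (isMatching_sumColorEquiv_iff hs m).symm

end Trinity

theorem mainTheorem11 {W B : Type*} [Finite W] [Finite B] (T : Trinity W B)
    (hT : T.IsToric) (c : TrinityColor) :
    (∀ S : Set W, T.IsWreath c S →
      Nat.card {m : T.TutteMatching // T.Extends c m S} = 2 ^ T.numCycles c S) ∧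
    (∃ S : Set W, T.IsWreath c S) ∧
    Nonempty T.TutteMatching := by
  have hH := T.isToric_toBipartiteMap hT c
  have card_extends (S : Set W) (hS : T.IsWreath c S) :
      Nat.card {m : T.TutteMatching // T.Extends c m S} = 2 ^ T.numCycles c S := by
    obtain ⟨s, hs, rfl⟩ := hS.exists_section (hT := hT.1)
    rw [Trinity.card_extends_range hs, Trinity.numCycles_range hs]
    exact BipartiteMap.card_isMatching hH hs ((Trinity.isWreath_range_iff hs).1 hS)
  obtain ⟨s, hs, hns⟩ := (T.toBipartiteMap hT.1 c).exists_isNonseparating_section hH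
  have hwreath : T.IsWreath c (Set.range s) := (Trinity.isWreath_range_iff hs).2 hns
  refine ⟨card_extends, ⟨_, hwreath⟩, ?_⟩
  have card_ne_zero := (card_extends _ hwreath).trans_ne (pow_ne_zero _ two_ne_zero)
  exact (Nat.card_ne_zero.1 card_ne_zero).1.map Subtype.val
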